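/- Let $F$ be an arbitrary field and let $A$ be a finite set of natural numbers. A *set composition* of $A$ is a tuple $P=(P_1,\ldots,P_l)$ of pairwise disjoint non-empty sets with union $A$; $\ell(P)=l$ is its length. The set $\Pi_A$ of all set compositions of $A$ is an idempotent monoid with product $$(P_1,\ldots,P_l)\wedge_A(Q_1,\ldots,Q_k)=(P_1\cap Q_1,\ldots,P_1\cap Q_k,\;\ldots,\;P_l\cap Q_1,\ldots,P_l\cap Q_k)^{\#},$$ where $\#$ means that empty sets are deleted; $F\Pi_A$ is its semigroup algebra over $F$. Write $Q\preceq P$ if each component of $Q$ is contained in a component of $P$. Let $\Pi_A^<$ be the set of those $(P_1,\ldots,P_l)\in\Pi_A$ with $\min P_1<\cdots<\min P_l$, and for $P,Q\in\Pi_A^<$ write $P\to Q$ if $Q\preceq P$ and $\ell(Q)=\ell(P)+1$, that is, if $P$ is obtained from $Q$ by merging two components (up to reordering). For $P\in\Pi_A$ let $M_P$ be the one-dimensional left $F\Pi_A$-module on which $R\in\Pi_A$ acts as $1$ if $P\preceq R$ and as $0$ otherwise; it is simple. The *Ext-quiver* of a finite-dimensional $F$-algebra all of whose simple modules are one-dimensional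 has the isomorphism classes of simple left modules as vertices, and $\dim_F\mathrm{Ext}^1(N,M)$ arrows from the class of $M$ to the class of $N$. (This number is the multiplicity of $M$ in the first Loewy layer $\mathrm{rad}\,\Lambda/\mathrm{rad}^2\Lambda$ of the projective cover $\Lambda$ of $N$.) A *support lattice* of an idempotent semigroup $S$ is a lattice $L$ with a surjective map $s:S\to L$ such that $s(xy)=s(x)\wedge s(y)$, and $s(x)\le s(y)$ if and only if $x=xyx$. The *Hasse diagram* of a partially ordered set is the quiver with one arrow from $x$ to $y$ whenever $x$ covers $y$, and no other arrows. **Theorem 8.1.** 1. The set of all set partitions of $A$, ordered by refinement (finer partitions being smaller), together with the map $s$ that sends $(P_1,\ldots,P_l)$ to $\{P_1,\ldots,P_l\}$, is a support lattice of $(\Pi_A,\wedge_A)$. 2. The Ext-quiver of $F\Pi_A$ is isomorphic to the Hasse diagram of this support lattice, by an isomorphism that takes $s(P)$ to the class of $M_P$, for each $P\in\Pi_A$. 3. The Ext-quiver of $F\Pi_A$ is isomorphic to the quiver $(\Pi_A^<,\to)$, with a single arrow from $P$ to $Q$ whenever $P\to Q$, by an isomorphism that takes $P$ to the class of $M_P$,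 for each $P\in\Pi_A^<$. 4. All arrows have multiplicity one: for all $P,Q\in\Pi_A^<$, $\dim_F\mathrm{Ext}^1(M_Q,M_P)$ is $1$ if $P\to Q$, and $0$ otherwise. -/

import Mathlib

open CategoryTheory

universe u v w

/-- A set composition (ordered set partition) of a finite set `A` of natural numbers: a tuple of
pairwise disjoint non-empty sets with union `A`. -/
@[ext]
structure SetComposition (A : Finset ℕ) where
  /-- The components, in order. -/
  parts : List (Finset ℕ)
  nonempty : ∀ p ∈ parts, p.Nonempty
  disjoint : parts.Pairwise Disjoint
  union : ∀ a, a ∈ A ↔ ∃ p ∈ parts, a ∈ p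

namespace SetComposition

variable {A : Finset ℕ}

/-- The number of components. -/
def length (P : SetComposition A) : ℕ := P.parts.length

/-- `Q.Refines P`: each component of `Q` is contained in a component of `P`. -/
def Refines (Q P : SetComposition A) : Prop := ∀ q ∈ Q.parts, ∃ p ∈ P.parts, q ⊆ p

/-- The list `(L₁ ∩ M₁, L₁ ∩ M₂, …, L₂ ∩ M₁, …)` with the empty sets deleted. -/
def interList (L M : List (Finset ℕ)) : List (Finset ℕ) :=
  (L.flatMap fun p => M.map fun q => p ∩ q).filter fun r => r.Nonempty

theorem mem_interList {L M : List (Finset ℕ)} {r : Finset ℕ} :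
    r ∈ interList L M ↔ (∃ p ∈ L, ∃ q ∈ M, p ∩ q = r) ∧ r.Nonempty := by
  simp [interList]

theorem interList_nil (M : List (Finset ℕ)) : interList [] M = [] := rfl

theorem interList_cons (p : Finset ℕ) (L M : List (Finset ℕ)) :
    interList (p :: L) M = (M.map fun q => p ∩ q).filter (fun r => r.Nonempty) ++
      interList L M := by
  simp [interList]

theorem interList_append (L L' M : List (Finset ℕ)) :
    interList (L ++ L') M = interList L M ++ interList L' M := by
  simp [interList]

theorem interList_filter (L M : List (Finset ℕ)) :
    interList (L.filter fun r => r.Nonempty) M = interList L M := by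
  induction L with
  | nil => rfl
  | cons p L ih =>
    by_cases hp : p.Nonempty
    · rw [List.filter_cons_of_pos (by simpa using hp), interList_cons, interList_cons, ih]
    · rw [List.filter_cons_of_neg (by simpa using hp), interList_cons, ih]
      rw [Finset.not_nonempty_iff_eq_empty] at hp
      subst hp
      simp

theorem inter_filter_map (p : Finset ℕ) (M : List (Finset ℕ)) :
    ((M.filter fun r => r.Nonempty).map fun q => p ∩ q).filter (fun r => r.Nonempty) =
      (M.map fun q => p ∩ q).filter (fun r => r.Nonempty) := by
  induction M with
  | nil => rfl
  | cons q M ih =>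
    by_cases hq : q.Nonempty
    · rw [List.filter_cons_of_pos (by simpa using hq)]
      simp only [List.map_cons, List.filter_cons, ih]
    · rw [List.filter_cons_of_neg (by simpa using hq), ih]
      rw [Finset.not_nonempty_iff_eq_empty] at hq
      subst hq
      simp

theorem interList_map (p : Finset ℕ) (M N : List (Finset ℕ)) :
    interList (M.map fun q => p ∩ q) N =
      ((interList M N).map fun q => p ∩ q).filter (fun r => r.Nonempty) := by
  induction M with
  | nil => rfl
  | cons q M ih =>
    rw [List.map_cons, interList_cons, interList_cons, ih, List.map_append, List.filter_append,
      inter_filter_map]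
    simp [Finset.inter_assoc, Function.comp_def]

theorem interList_assoc (L M N : List (Finset ℕ)) :
    interList (interList L M) N = interList L (interList M N) := by
  induction L with
  | nil => rfl
  | cons p L ih =>
    rw [interList_cons, interList_cons, interList_append, interList_filter, ih, interList_map]

/-- The product `(P₁, …, P_l) ∧ (Q₁, …, Q_k) = (P₁ ∩ Q₁, …, P₁ ∩ Q_k, …, P_l ∩ Q_k)`, with empty
sets deleted. -/
instance : Mul (SetComposition A) where
  mul P Q :=
    { parts := interList P.parts Q.parts
      nonempty := fun r hr => (mem_interList.1 hr).2
      disjoint := by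
        refine List.Pairwise.filter _ (List.pairwise_flatMap.2 ⟨fun p _ => ?_, ?_⟩)
        · exact List.pairwise_map.2 (Q.disjoint.imp fun {a b} h =>
            h.mono Finset.inter_subset_right Finset.inter_subset_right)
        · refine P.disjoint.imp fun {a b} h x hx y hy => ?_
          obtain ⟨q, _, rfl⟩ := List.mem_map.1 hx
          obtain ⟨q', _, rfl⟩ := List.mem_map.1 hy
          exact h.mono Finset.inter_subset_left Finset.inter_subset_left
      union := fun a => by
        constructor
        · intro ha
          obtain ⟨p, hp, hap⟩ := (P.union a).1 ha
          obtain ⟨q, hq, haq⟩ := (Q.union a).1 ha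
          have h : a ∈ p ∩ q := Finset.mem_inter.2 ⟨hap, haq⟩
          exact ⟨p ∩ q, mem_interList.2 ⟨⟨p, hp, q, hq, rfl⟩, a, h⟩, h⟩
        · rintro ⟨r, hr, har⟩
          obtain ⟨⟨p, hp, q, hq, rfl⟩, _⟩ := mem_interList.1 hr
          exact (P.union a).2 ⟨p, hp, (Finset.mem_inter.1 har).1⟩ }

/-- The identity is the composition `(A)` with one component (the empty tuple if `A = ∅`). -/
instance : One (SetComposition A) where
  one :=
    { parts := [A].filter fun r => r.Nonempty
      nonempty := fun p hp => by simpa using (List.mem_filter.1 hp).2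
      disjoint := List.Pairwise.filter _ (List.pairwise_singleton _ _)
      union := fun a => by
        constructor
        · intro ha
          exact ⟨A, List.mem_filter.2 ⟨by simp, by simpa using ⟨a, ha⟩⟩, ha⟩
        · rintro ⟨p, hp, hap⟩
          have : p = A := by simpa using (List.mem_filter.1 hp).1
          exact this ▸ hap }

theorem mul_parts (P Q : SetComposition A) : (P * Q).parts = interList P.parts Q.parts := rfl

theorem one_parts : (1 : SetComposition A).parts = [A].filter fun r => r.Nonempty := rfl

theorem subset_of_mem (P : SetComposition A) {p : Finset ℕ} (hp : p ∈ P.parts) : p ⊆ A :=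
  fun a ha => (P.union a).2 ⟨p, hp, ha⟩

theorem filter_parts (P : SetComposition A) :
    (P.parts.filter fun r => r.Nonempty) = P.parts :=
  List.filter_eq_self.2 fun p hp => by simpa using P.nonempty p hp

/-- The monoid `(Π_A, ∧_A)` of set compositions of `A`. -/
instance : Monoid (SetComposition A) where
  mul_assoc P Q R := SetComposition.ext (interList_assoc _ _ _)
  one_mul P := by
    refine SetComposition.ext ?_
    rw [mul_parts, one_parts, interList_filter, interList_cons, interList_nil, List.append_nil]
    have h : (P.parts.map fun q => A ∩ q) = P.parts := by
      conv_rhs => rw [← List.map_id P.parts]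
      exact List.map_congr_left fun q hq => Finset.inter_eq_right.2 (P.subset_of_mem hq)
    rw [h, filter_parts]
  mul_one P := by
    refine SetComposition.ext ?_
    rw [mul_parts, one_parts]
    have h : ∀ L : List (Finset ℕ), (∀ p ∈ L, p.Nonempty ∧ p ⊆ A) →
        interList L ([A].filter fun r => r.Nonempty) = L := by
      intro L
      induction L with
      | nil => intro _; rfl
      | cons p L ih =>
        intro hL
        have hp := hL p (by simp)
        rw [interList_cons, ih fun q hq => hL q (by simp [hq]), inter_filter_map]
        simp [Finset.inter_eq_left.2 hp.2, hp.1]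
    exact h _ fun p hp => ⟨P.nonempty p hp, P.subset_of_mem hp⟩

/-- The set partition of `A` obtained from a set composition by forgetting the order of its
components. Set partitions are ordered by refinement, the finer one being the smaller one. -/
def support (P : SetComposition A) : Finpartition A where
  parts := P.parts.toFinset
  supIndep := by
    rw [Finset.supIndep_iff_pairwiseDisjoint]
    intro p hp q hq hpq
    exact P.disjoint.forall (List.mem_toFinset.1 hp) (List.mem_toFinset.1 hq) hpq
  sup_parts := by
    ext a
    simp [Finset.mem_sup, P.union a]
  bot_notMem := by
    intro h
    simpa using P.nonempty _ (List.mem_toFinset.1 h)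

theorem refines_one (P : SetComposition A) : P.Refines 1 := by
  intro p hp
  obtain ⟨a, ha⟩ := P.nonempty p hp
  exact ⟨A, List.mem_filter.2 ⟨by simp, by simpa using ⟨a, P.subset_of_mem hp ha⟩⟩,
    P.subset_of_mem hp⟩

theorem refines_mul_iff (P Q R : SetComposition A) :
    P.Refines (Q * R) ↔ P.Refines Q ∧ P.Refines R := by
  constructor
  · intro h
    refine ⟨fun p hp => ?_, fun p hp => ?_⟩ <;>
    · obtain ⟨s, hs, hps⟩ := h p hp
      obtain ⟨⟨q, hq, r, hr, rfl⟩, _⟩ := mem_interList.1 hs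
      first
        | exact ⟨q, hq, hps.trans Finset.inter_subset_left⟩
        | exact ⟨r, hr, hps.trans Finset.inter_subset_right⟩
  · rintro ⟨h₁, h₂⟩ p hp
    obtain ⟨q, hq, hpq⟩ := h₁ p hp
    obtain ⟨r, hr, hpr⟩ := h₂ p hp
    have h := Finset.subset_inter hpq hpr
    exact ⟨q ∩ r, mem_interList.2 ⟨⟨q, hq, r, hr, rfl⟩, (P.nonempty p hp).mono h⟩, h⟩

open Classical in
/-- The multiplicative character of `Π_A` belonging to `P`: it is `1` at `R` if `P` refines `R`,
and `0` otherwise. -/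
noncomputable def character (F : Type u) [Field F] (P : SetComposition A) :
    SetComposition A →* F where
  toFun R := if P.Refines R then 1 else 0
  map_one' := if_pos P.refines_one
  map_mul' Q R := by
    by_cases h₁ : P.Refines Q <;> by_cases h₂ : P.Refines R <;> simp [refines_mul_iff, h₁, h₂]

end SetComposition

/-- The Solomon-Tits algebra `F Π_A`: the semigroup algebra of `(Π_A, ∧_A)` over `F`. -/
abbrev SolomonTits (F : Type u) [Field F] (A : Finset ℕ) : Type u :=
  MonoidAlgebra F (SetComposition A)

/-- The linear extension of the character belonging to `P` to the algebra `F Π_A`. -/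
noncomputable def SetComposition.characterHom (F : Type u) [Field F] {A : Finset ℕ}
    (P : SetComposition A) : SolomonTits F A →ₐ[F] F :=
  MonoidAlgebra.lift F F (SetComposition A) (P.character F)

/-- The one-dimensional left `F Π_A`-module `M_P`: the vector space `F` on which `R ∈ Π_A` acts as
`1` if `P` refines `R`, and as `0` otherwise. -/
noncomputable def SetComposition.irreducibleModule (F : Type u) [Field F] {A : Finset ℕ}
    (P : SetComposition A) : ModuleCat.{u} (SolomonTits F A) :=
  (ModuleCat.restrictScalars (P.characterHom F).toRingHom).obj (ModuleCat.of F F)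

/-- The type of simple left modules over a ring `R`. -/
def SimpleMod (R : Type v) [Ring R] : Type (v + 1) :=
  {M : ModuleCat.{v} R // IsSimpleModule R M}

/-- Two simple modules are identified when they are isomorphic. -/
instance SimpleMod.setoid (R : Type v) [Ring R] : Setoid (SimpleMod R) where
  r M N := Nonempty (M.1 ≅ N.1)
  iseqv :=
    { refl := fun M => ⟨Iso.refl M.1⟩
      symm := fun ⟨e⟩ => ⟨e.symm⟩
      trans := fun ⟨e⟩ ⟨f⟩ => ⟨e.trans f⟩ }

/-- The vertices of the Ext-quiver of an `F`-algebra `R`: the isomorphism classes of simple left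
`R`-modules. -/
def ExtQuiver (F : Type u) [Field F] (R : Type v) [Ring R] [Algebra F R] : Type (v + 1) :=
  Quotient (SimpleMod.setoid R)

/-- The arrows of the Ext-quiver. If `x` and `y` are the classes of the simple modules `M` and `N`,
then the arrows from `x` to `y` are the members of an `F`-basis of `Ext¹(N, M)`, so that their
number is `dim Ext¹(N, M)`. For a finite-dimensional algebra all of whose simple modules are
one-dimensional, this number is the multiplicity of `M` in the first Loewy layer `rad Λ / rad² Λ` of the projective
cover `Λ` of `N`. -/
noncomputable instance ExtQuiver.quiver (F : Type u) [Field F] (R : Type v) [Ring R]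
    [Algebra F R] : Quiver.{v} (ExtQuiver F R) where
  Hom x y := Module.Basis.ofVectorSpaceIndex F
    (Abelian.Ext.{v} (Quotient.out (s := SimpleMod.setoid R) y).1
      (Quotient.out (s := SimpleMod.setoid R) x).1 1)

theorem SetComposition.isSimpleModule_irreducibleModule (F : Type u) [Field F] {A : Finset ℕ}
    (P : SetComposition A) :
    IsSimpleModule (SolomonTits F A) (P.irreducibleModule F) := by
  have hn : Nontrivial (P.irreducibleModule F) := inferInstanceAs (Nontrivial F)
  rw [isSimpleModule_iff_toSpanSingleton_surjective]
  refine ⟨hn, fun m hm n => ?_⟩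
  have hm' : (show F from m) ≠ 0 := hm
  refine ⟨algebraMap F (SolomonTits F A) ((show F from n) / (show F from m)), ?_⟩
  change P.characterHom F (algebraMap F (SolomonTits F A) ((show F from n) / (show F from m))) *
    (show F from m) = (show F from n)
  rw [AlgHom.commutes]
  exact div_mul_cancel₀ _ hm'

/-- The vertex of the Ext-quiver of `F Π_A` given by the simple module `M_P`. -/
noncomputable def SetComposition.vertex (F : Type u) [Field F] {A : Finset ℕ}
    (P : SetComposition A) : ExtQuiver F (SolomonTits F A) :=
  Quotient.mk (SimpleMod.setoid (SolomonTits F A))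
    ⟨P.irreducibleModule F, P.isSimpleModule_irreducibleModule F⟩

/-- The set `Π_A^<` of set compositions `(P₁, …, P_l)` of `A` with `min P₁ < ⋯ < min P_l`. -/
def OrderedComposition (A : Finset ℕ) : Type :=
  {P : SetComposition A // P.parts.Pairwise fun p q => p.min < q.min}

/-- `Arrow P Q` is the relation `P → Q`: `P` is obtained from `Q` by merging two components, that
is, `Q` refines `P` and has exactly one component more. -/
def OrderedComposition.Arrow {A : Finset ℕ} (P Q : OrderedComposition A) : Prop :=
  Q.1.Refines P.1 ∧ Q.1.length = P.1.length + 1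

/-- The quiver `(Π_A^<, →)`, with a single arrow from `P` to `Q` whenever `P → Q`. -/
instance OrderedComposition.quiver (A : Finset ℕ) : Quiver.{0} (OrderedComposition A) where
  Hom P Q := PLift (P.Arrow Q)

/-- The Hasse diagram of a partially ordered set `L`, as a quiver: there is a single arrow from `x`
to `y` whenever `x` covers `y`. -/
def HasseQuiver (L : Type w) : Type w := L

instance HasseQuiver.quiver (L : Type w) [PartialOrder L] : Quiver.{0} (HasseQuiver L) where
  Hom x y := PLift (@CovBy L _ y x)

/-- A morphism of quivers is an isomorphism if it is bijective on vertices and on arrows. -/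
def Prefunctor.IsIsomorphism {V : Type u} [Quiver.{v} V] {W : Type w} [Quiver W]
    (φ : Prefunctor V W) : Prop :=
  Function.Bijective φ.obj ∧
    ∀ x y : V, Function.Bijective (φ.map : (x ⟶ y) → (φ.obj x ⟶ φ.obj y))

/-- `L` is a support lattice of the idempotent semigroup `S` with support map `s`: any two elements
of `L` have a least upper bound and a greatest lower bound, `s` is surjective, `s (x y)` is the
greatest lower bound of `s x` and `s y`, and `s x ≤ s y` if and only if `x = x y x`. -/
structure IsSupportLattice {S : Type v} [Mul S] {L : Type w} [PartialOrder L] (s : S → L) :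
    Prop where
  exists_isLUB : ∀ a b : L, ∃ c, IsLUB {a, b} c
  exists_isGLB : ∀ a b : L, ∃ c, IsGLB {a, b} c
  surjective : Function.Surjective s
  isGLB_mul : ∀ x y, IsGLB {s x, s y} (s (x * y))
  le_iff : ∀ x y, s x ≤ s y ↔ x = x * y * x

/-! ### Ext¹ computed from a presentation with projective middle term -/

section ExtOfPresentation

open Abelian

variable {C : Type v} [Category.{w} C] [Abelian C] [HasExt.{u} C] {k : Type*} [Field k]
  [Linear k C]

/-! The support lattice rests on two identities: PQP = PQ, and PQ = P exactly when P refines Q.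
Write χ_P for the character of P. Every simple module is some M_P (`exists_smul_eq_character_smul`),
and M_P, M_Q are isomorphic exactly when P and Q have the same support. So the vertices are the set
partitions, and the task is to compute Ext¹(M_Q, M_P).

Presenting M_Q by the regular module turns Ext¹(M_Q, M_P) into the space of functionals d with d(rs)
= χ_P(r)d(s) + d(r)χ_Q(s), modulo the inner ones, the multiples of χ_P − χ_Q. Such a d is determined
by its restriction δ to Π_A. Idempotence makes δ vanish wherever χ_P and χ_Q agree, and PSP = PS
makes δ inner unless Q refines P.

Suppose Q refines P. Only those R matter that are refined by Q but not by P. Let U be the union of a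
suitable initial segment of R. The cut (U, A∖U) fixes R under left multiplication and is not refined
by P, whence δ(R) = δ(U, A∖U). Nested cuts commute, so U can be shrunk to one component b of Q
(`exists_part_forall_isSkew_eq`). Thus δ is determined by its values at the cuts along those
components of Q that are not components of P.

If P merges just two components b, c of Q, there are two such values. Inner functions account for
the pairs of equal values, and "x precedes y" with x in b, y in c is a non-inner solution
(`exists_isSkew_of_covBy`); Ext¹ has dimension one. Otherwise comparison with cuts along unions of
two components forces all values to coincide (`IsSkew.cut_eq_cut_of_not_covBy`), δ is inner and Ext¹
= 0. Hence the Ext-quiver is the Hasse diagram, over any field. Sorting components by their minima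
identifies Π_A^< with the set partitions. -/

theorem CategoryTheory.ShortComplex.ShortExact.exists_extClass_comp_eq {S : ShortComplex C}
    (hS : S.ShortExact) [Projective S.X₂] {Y : C} (x : Ext.{u} S.X₃ Y 1) :
    ∃ f : S.X₁ ⟶ Y, hS.extClass.comp (Ext.mk₀ f) (add_zero 1) = x := by
  obtain ⟨x₁, hx₁⟩ := Ext.contravariant_sequence_exact₃ hS Y x (Ext.eq_zero_of_projective _)
    (add_zero 1)
  obtain ⟨f, rfl⟩ := (Ext.mk₀_bijective _ _).2 x₁
  exact ⟨f, hx₁⟩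

/-- Exactness at Hom(X₁, Y) in the long exact sequence. With a projective middle term, Ext¹ is
therefore Hom(X₁, Y) modulo the maps that extend to X₂. -/
theorem CategoryTheory.ShortComplex.ShortExact.extClass_comp_eq_zero_iff {S : ShortComplex C}
    (hS : S.ShortExact) {Y : C} (f : S.X₁ ⟶ Y) :
    hS.extClass.comp (Ext.mk₀ f) (add_zero 1) = 0 ↔ ∃ g : S.X₂ ⟶ Y, S.f ≫ g = f := by
  constructor
  · intro h
    obtain ⟨x₂, hx₂⟩ := Ext.contravariant_sequence_exact₁ hS Y _ (add_zero 1) h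
    obtain ⟨g, rfl⟩ := (Ext.mk₀_bijective _ _).2 x₂
    rw [Ext.mk₀_comp_mk₀] at hx₂
    exact ⟨g, (Ext.mk₀_bijective _ _).1 hx₂⟩
  · rintro ⟨g, rfl⟩
    rw [← Ext.mk₀_comp_mk₀, hS.extClass_comp_assoc]

theorem CategoryTheory.ShortComplex.ShortExact.rank_ext_one_eq_zero {S : ShortComplex C}
    (hS : S.ShortExact) [Projective S.X₂] {Y : C}
    (h : ∀ f : S.X₁ ⟶ Y, ∃ g : S.X₂ ⟶ Y, S.f ≫ g = f) :
    Module.rank k (Ext.{u} S.X₃ Y 1) = 0 := by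
  rw [rank_zero_iff_forall_zero]
  intro x
  obtain ⟨f, rfl⟩ := hS.exists_extClass_comp_eq x
  exact (hS.extClass_comp_eq_zero_iff f).2 (h f)

theorem CategoryTheory.ShortComplex.ShortExact.rank_ext_one_eq_one {S : ShortComplex C}
    (hS : S.ShortExact) [Projective S.X₂] {Y : C} (f₀ : S.X₁ ⟶ Y)
    (hf₀ : ¬ ∃ g : S.X₂ ⟶ Y, S.f ≫ g = f₀)
    (h : ∀ f : S.X₁ ⟶ Y, ∃ (c : k) (g : S.X₂ ⟶ Y), f = c • f₀ + S.f ≫ g) :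
    Module.rank k (Ext.{u} S.X₃ Y 1) = 1 := by
  refine rank_eq_one (hS.extClass.comp (Ext.mk₀ f₀) (add_zero 1))
    (fun h0 => hf₀ ((hS.extClass_comp_eq_zero_iff f₀).1 h0)) fun x => ?_
  obtain ⟨f, rfl⟩ := hS.exists_extClass_comp_eq x
  obtain ⟨c, g, rfl⟩ := h f
  refine ⟨c, ?_⟩
  rw [Ext.mk₀_add, Ext.comp_add, (hS.extClass_comp_eq_zero_iff (S.f ≫ g)).2 ⟨g, rfl⟩, add_zero,
    Ext.mk₀_smul, Ext.comp_smul]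

end ExtOfPresentation

/-! ### One-dimensional modules: Ext¹ as skew derivations modulo inner ones -/

section CharacterModules

variable (F : Type u) [Field F] {R : Type u} [Ring R] [Algebra F R]

/-- The one-dimensional module on which the algebra acts through a character. -/
noncomputable abbrev characterModule (χ : R →ₐ[F] F) : ModuleCat.{u} R :=
  (ModuleCat.restrictScalars χ.toRingHom).obj (ModuleCat.of F F)

variable {F}

/-- The character as a module homomorphism from the regular module. -/
noncomputable def characterProj (χ : R →ₐ[F] F) : ModuleCat.of R R ⟶ characterModule F χ :=
  ModuleCat.ofHom (Y := characterModule F χ)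
    { toFun := fun r => (χ r : F)
      map_add' := fun r s => map_add χ r s
      map_smul' := fun r s => map_mul χ r s }

/-- The kernel of a character, as a module. -/
noncomputable abbrev characterKer (χ : R →ₐ[F] F) : ModuleCat.{u} R :=
  ModuleCat.of R (LinearMap.ker (characterProj χ).hom)

/-- The presentation of a one-dimensional module by the regular module. -/
noncomputable abbrev characterComplex (χ : R →ₐ[F] F) : ShortComplex (ModuleCat.{u} R) :=
  ShortComplex.mk (X₁ := characterKer χ)
    (ModuleCat.ofHom (LinearMap.ker (characterProj χ).hom).subtype) (characterProj χ) (by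
      ext x; exact x.2)

theorem characterComplex_shortExact (χ : R →ₐ[F] F) : (characterComplex χ).ShortExact where
  exact := by
    rw [ShortComplex.moduleCat_exact_iff]
    intro x hx
    exact ⟨⟨x, hx⟩, rfl⟩
  mono_f := (ModuleCat.mono_iff_injective _).2 Subtype.val_injective
  epi_g := (ModuleCat.epi_iff_surjective _).2 fun c =>
    ⟨algebraMap F R (show F from c), χ.commutes _⟩

/-- A linear functional `d` with `d (r s) = ψ r d s + d r χ s`. -/
def IsSkewDerivation (ψ χ : R →ₐ[F] F) (d : R →ₗ[F] F) : Prop :=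
  ∀ r s, d (r * s) = ψ r * d s + d r * χ s

theorem mem_ker_characterProj {χ : R →ₐ[F] F} {x : R} :
    x ∈ LinearMap.ker (characterProj χ).hom ↔ χ x = 0 := Iff.rfl

/-- The restriction of a skew derivation to the kernel of the right-hand character. -/
noncomputable def IsSkewDerivation.hom {ψ χ : R →ₐ[F] F} {d : R →ₗ[F] F}
    (hd : IsSkewDerivation ψ χ d) : characterKer χ ⟶ characterModule F ψ :=
  ModuleCat.ofHom (Y := characterModule F ψ)
    { toFun := fun x => (d x.1 : F)
      map_add' := fun x y => map_add d x.1 y.1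
      map_smul' := fun r x => by
        have hx : χ x.1 = 0 := x.2
        refine (hd r x.1).trans ?_
        rw [hx, mul_zero, add_zero]
        rfl }

/-- Every r splits as χ(r) plus an element of ker χ; letting f act on the second summand gives d.
The derivation rule comes from rs − χ(rs) = r(s − χ(s)) + χ(s)(r − χ(r)). -/
theorem exists_isSkewDerivation_hom_eq {ψ χ : R →ₐ[F] F}
    (f : characterKer χ ⟶ characterModule F ψ) :
    ∃ (d : R →ₗ[F] F) (hd : IsSkewDerivation ψ χ d), hd.hom = f := by
  have hmem : ∀ r : R, r - algebraMap F R (χ r) ∈ LinearMap.ker (characterProj χ).hom := by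
    intro r
    rw [mem_ker_characterProj]
    simp
  let g : LinearMap.ker (characterProj χ).hom → F := fun x => f.hom x
  have gadd : ∀ x y, g (x + y) = g x + g y := fun x y => map_add f.hom x y
  have gsmul : ∀ (r : R) x, g (r • x) = ψ r * g x := fun r x => map_smul f.hom r x
  have gcast : ∀ (c : F) x, g (algebraMap F R c • x) = c * g x := fun c x => by
    rw [gsmul, AlgHom.commutes]; rfl
  let d : R →ₗ[F] F :=
    { toFun := fun r => g ⟨r - algebraMap F R (χ r), hmem r⟩
      map_add' := fun r s => by
        rw [← gadd]
        congr 1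
        ext
        simp only [map_add, Submodule.coe_add]
        abel
      map_smul' := fun c r => by
        rw [RingHom.id_apply, smul_eq_mul, ← gcast]
        congr 1
        ext
        simp only [smul_eq_mul, map_mul, Submodule.coe_smul, mul_sub, Algebra.smul_def,
          AlgHom.commutes, Algebra.algebraMap_self, RingHom.id_apply] }
  refine ⟨d, fun r s => ?_, ?_⟩
  · change g _ = ψ r * g _ + g _ * χ s
    rw [← gsmul, mul_comm _ (χ s), ← gcast, ← gadd]
    congr 1
    ext
    simp only [map_mul, Submodule.coe_add, Submodule.coe_smul, smul_eq_mul, mul_sub]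
    rw [← Algebra.commutes (χ s) r, ← map_mul (algebraMap F R), ← map_mul (algebraMap F R),
      mul_comm (χ s)]
    abel
  · ext x
    change g _ = g x
    congr 1
    ext
    have hx : χ x.1 = 0 := x.2
    simp [hx]

/-- Extending the homomorphism given by a skew derivation to the regular module means that the
skew derivation is inner. -/
theorem IsSkewDerivation.hom_extends_iff {ψ χ : R →ₐ[F] F} {d : R →ₗ[F] F}
    (hd : IsSkewDerivation ψ χ d) :
    (∃ g : ModuleCat.of R R ⟶ characterModule F ψ, (characterComplex χ).f ≫ g = hd.hom) ↔
      ∃ c : F, ∀ r, d r = c * (ψ r - χ r) := by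
  constructor
  · rintro ⟨g, hg⟩
    -- A map from the regular module is determined by g(1). Since d(1) = 0, evaluating at r − χ(r)
    -- yields d(r) = g(1)(ψ(r) − χ(r)).
    refine ⟨(show F from g.hom (1 : R)), fun r => ?_⟩
    have h1 : d 1 = 0 := by
      have := hd 1 1
      simpa using this
    have hmem : r - algebraMap F R (χ r) ∈ LinearMap.ker (characterProj χ).hom := by
      rw [mem_ker_characterProj]
      simp
    have hgr : ∀ s : R, (show F from g.hom s) = ψ s * (show F from g.hom (1 : R)) := fun s => by
      have := map_smul g.hom s (1 : R)
      rw [smul_eq_mul, mul_one] at this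
      exact this
    have h2 : (show F from g.hom (r - algebraMap F R (χ r))) = d (r - algebraMap F R (χ r)) :=
      congrArg (fun φ : characterKer χ ⟶ characterModule F ψ => φ.hom ⟨_, hmem⟩) hg
    rw [hgr, map_sub, map_sub, Algebra.algebraMap_eq_smul_one, map_smul, map_smul, h1, map_one,
      smul_zero, sub_zero, smul_eq_mul, mul_one] at h2
    rw [← h2, mul_comm]
  · rintro ⟨c, hc⟩
    refine ⟨ModuleCat.ofHom (Y := characterModule F ψ)
      { toFun := fun r => (ψ r * c : F)
        map_add' := fun r s => by rw [map_add, add_mul]; rfl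
        map_smul' := fun r s => by
          rw [smul_eq_mul, map_mul, mul_assoc]; rfl }, ?_⟩
    ext x
    have hx : χ x.1 = 0 := x.2
    change ψ x.1 * c = d x.1
    rw [hc, hx, sub_zero, mul_comm]

theorem rank_ext_characterModule_eq_zero {ψ χ : R →ₐ[F] F}
    (h : ∀ d : R →ₗ[F] F, IsSkewDerivation ψ χ d → ∃ c : F, ∀ r, d r = c * (ψ r - χ r)) :
    Module.rank F (Abelian.Ext.{u} (characterModule F χ) (characterModule F ψ) 1) = 0 := by
  have : Projective (characterComplex χ).X₂ :=
    ModuleCat.projective_of_free (Module.Basis.singleton Unit R)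
  refine (characterComplex_shortExact χ).rank_ext_one_eq_zero fun f => ?_
  obtain ⟨d, hd, rfl⟩ := exists_isSkewDerivation_hom_eq f
  exact hd.hom_extends_iff.2 (h d hd)

theorem rank_ext_characterModule_eq_one {ψ χ : R →ₐ[F] F} (d₀ : R →ₗ[F] F)
    (hd₀ : IsSkewDerivation ψ χ d₀) (hd₀' : ¬ ∃ c : F, ∀ r, d₀ r = c * (ψ r - χ r))
    (h : ∀ d : R →ₗ[F] F, IsSkewDerivation ψ χ d →
      ∃ a c : F, ∀ r, d r = a * d₀ r + c * (ψ r - χ r)) :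
    Module.rank F (Abelian.Ext.{u} (characterModule F χ) (characterModule F ψ) 1) = 1 := by
  have : Projective (characterComplex χ).X₂ :=
    ModuleCat.projective_of_free (Module.Basis.singleton Unit R)
  refine (characterComplex_shortExact χ).rank_ext_one_eq_one hd₀.hom
    (fun h0 => hd₀' (hd₀.hom_extends_iff.1 h0)) fun f => ?_
  obtain ⟨d, hd, rfl⟩ := exists_isSkewDerivation_hom_eq f
  obtain ⟨a, c, hac⟩ := h d hd
  have hin : IsSkewDerivation ψ χ (d - a • d₀) := fun r s => by
    simp only [LinearMap.sub_apply, LinearMap.smul_apply, smul_eq_mul, hd r s, hd₀ r s]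
    ring
  obtain ⟨g, hg⟩ := hin.hom_extends_iff.2 ⟨c, fun r => by simp [hac r]⟩
  refine ⟨a, g, ?_⟩
  rw [hg]
  ext x
  change d x.1 = (ψ (algebraMap F R a) * d₀ x.1 : F) + (d x.1 - a * d₀ x.1)
  rw [AlgHom.commutes]
  exact (add_sub_cancel _ _).symm

end CharacterModules

/-! ### Refinement and two-component cuts -/

namespace SetComposition

variable {A : Finset ℕ}

theorem filter_map_inter_eq_nil {p : Finset ℕ} {M : List (Finset ℕ)}
    (h : ∀ q ∈ M, Disjoint p q) :
    ((M.map fun q => p ∩ q).filter fun r => r.Nonempty) = [] := by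
  rw [List.filter_eq_nil_iff]
  intro r hr
  obtain ⟨q, hq, rfl⟩ := List.mem_map.1 hr
  simp [Finset.disjoint_iff_inter_eq_empty.1 (h q hq)]

theorem filter_map_inter_eq_self {p : Finset ℕ} {M : List (Finset ℕ)}
    (h : ∀ q ∈ M, q ⊆ p ∧ q.Nonempty) :
    ((M.map fun q => p ∩ q).filter fun r => r.Nonempty) = M := by
  have h1 : (M.map fun q => p ∩ q) = M := by
    conv_rhs => rw [← List.map_id M]
    exact List.map_congr_left fun q hq => Finset.inter_eq_right.2 (h q hq).1
  rw [h1, List.filter_eq_self]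
  exact fun q hq => by simpa using (h q hq).2

theorem filter_map_inter_eq_singleton {p : Finset ℕ} {M : List (Finset ℕ)} (hp : p.Nonempty)
    (hM : M.Pairwise Disjoint) (h : ∃ q ∈ M, p ⊆ q) :
    ((M.map fun q => p ∩ q).filter fun r => r.Nonempty) = [p] := by
  obtain ⟨q, hq, hpq⟩ := h
  obtain ⟨M₁, M₂, rfl⟩ := List.append_of_mem hq
  rw [List.pairwise_append, List.pairwise_cons] at hM
  rw [List.map_append, List.map_cons, List.filter_append, filter_map_inter_eq_nil, List.nil_append,
    Finset.inter_eq_left.2 hpq, List.filter_cons_of_pos (by simpa using hp),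
    filter_map_inter_eq_nil]
  · exact fun r hr => (hM.2.1.1 r hr).mono_left hpq
  · exact fun r hr => (hM.2.2 r hr q (by simp)).symm.mono_left hpq

theorem Refines.refl (P : SetComposition A) : P.Refines P := fun p hp => ⟨p, hp, subset_rfl⟩

theorem Refines.trans {P Q R : SetComposition A} (h : P.Refines Q) (h' : Q.Refines R) :
    P.Refines R := fun p hp => by
  obtain ⟨q, hq, hpq⟩ := h p hp
  obtain ⟨r, hr, hqr⟩ := h' q hq
  exact ⟨r, hr, hpq.trans hqr⟩

/-- If P refines Q, each component of P meets exactly one component of Q and is contained in it, so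
intersecting reproduces the list P unchanged. -/
theorem mul_eq_left_iff {P Q : SetComposition A} : P * Q = P ↔ P.Refines Q := by
  constructor
  · intro h
    have h' : P.Refines (P * Q) := h.symm ▸ Refines.refl P
    exact ((refines_mul_iff _ _ _).1 h').2
  · intro h
    have key : ∀ L : List (Finset ℕ), (∀ p ∈ L, p.Nonempty ∧ ∃ q ∈ Q.parts, p ⊆ q) →
        interList L Q.parts = L := by
      intro L
      induction L with
      | nil => intro _; rfl
      | cons p L ih =>
        intro hL
        rw [interList_cons, ih fun q hq => hL q (by simp [hq]),
          filter_map_inter_eq_singleton (hL p (by simp)).1 Q.disjoint (hL p (by simp)).2]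
        rfl
    exact SetComposition.ext (key _ fun p hp => ⟨P.nonempty p hp, h p hp⟩)

theorem mul_self (P : SetComposition A) : P * P = P := mul_eq_left_iff.2 (Refines.refl P)

theorem mul_refines_left (P Q : SetComposition A) : (P * Q).Refines P :=
  ((refines_mul_iff _ _ _).1 (Refines.refl (P * Q))).1

theorem mul_refines_right (P Q : SetComposition A) : (P * Q).Refines Q :=
  ((refines_mul_iff _ _ _).1 (Refines.refl (P * Q))).2

theorem mul_mul_cancel (P Q : SetComposition A) : P * Q * P = P * Q :=
  mul_eq_left_iff.2 (mul_refines_left P Q)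

/-- Two elements lie in the same component. -/
def Rel (P : SetComposition A) (a b : ℕ) : Prop := ∃ p ∈ P.parts, a ∈ p ∧ b ∈ p

theorem eq_of_mem_of_mem (P : SetComposition A) {p q : Finset ℕ} (hp : p ∈ P.parts)
    (hq : q ∈ P.parts) {a : ℕ} (hap : a ∈ p) (haq : a ∈ q) : p = q := by
  by_contra hne
  exact Finset.disjoint_left.1 (P.disjoint.forall hp hq hne) hap haq

theorem Rel.symm {P : SetComposition A} {a b : ℕ} (h : P.Rel a b) : P.Rel b a := by
  obtain ⟨p, hp, ha, hb⟩ := h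
  exact ⟨p, hp, hb, ha⟩

theorem Rel.mem_left {P : SetComposition A} {a b : ℕ} (h : P.Rel a b) : a ∈ A := by
  obtain ⟨p, hp, ha, hb⟩ := h
  exact P.subset_of_mem hp ha

theorem rel_iff_mem {P : SetComposition A} {p : Finset ℕ} (hp : p ∈ P.parts) {a b : ℕ}
    (ha : a ∈ p) : P.Rel a b ↔ b ∈ p := by
  constructor
  · rintro ⟨q, hq, haq, hbq⟩
    rwa [P.eq_of_mem_of_mem hp hq ha haq]
  · exact fun hb => ⟨p, hp, ha, hb⟩

theorem refines_iff_rel {P Q : SetComposition A} :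
    P.Refines Q ↔ ∀ a b, P.Rel a b → Q.Rel a b := by
  constructor
  · rintro h a b ⟨p, hp, ha, hb⟩
    obtain ⟨q, hq, hpq⟩ := h p hp
    exact ⟨q, hq, hpq ha, hpq hb⟩
  · intro h p hp
    obtain ⟨a, ha⟩ := P.nonempty p hp
    obtain ⟨q, hq, haq, -⟩ := h a a ⟨p, hp, ha, ha⟩
    exact ⟨q, hq, fun b hb => (rel_iff_mem hq haq).1 (h a b ⟨p, hp, ha, hb⟩)⟩

/-- The set composition `(U, A \ U)`, with empty sets deleted. -/
def cut (A U : Finset ℕ) : SetComposition A where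
  parts := [A ∩ U, A \ U].filter fun r => r.Nonempty
  nonempty := fun p hp => by simpa using (List.mem_filter.1 hp).2
  disjoint := List.Pairwise.filter _ (by simpa using (Finset.disjoint_sdiff_inter A U).symm)
  union := fun a => by
    simp only [List.mem_filter, List.mem_cons, List.not_mem_nil, or_false, decide_eq_true_eq]
    constructor
    · intro ha
      by_cases haU : a ∈ U
      · exact ⟨A ∩ U, ⟨Or.inl rfl, a, by simp [ha, haU]⟩, by simp [ha, haU]⟩
      · exact ⟨A \ U, ⟨Or.inr rfl, a, by simp [ha, haU]⟩, by simp [ha, haU]⟩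
    · rintro ⟨p, ⟨rfl | rfl, -⟩, ha⟩
      · exact (Finset.mem_inter.1 ha).1
      · exact (Finset.mem_sdiff.1 ha).1

theorem cut_parts (U : Finset ℕ) :
    (cut A U).parts = [A ∩ U, A \ U].filter fun r => r.Nonempty := rfl

theorem rel_cut {U : Finset ℕ} {a b : ℕ} :
    (cut A U).Rel a b ↔ a ∈ A ∧ b ∈ A ∧ (a ∈ U ↔ b ∈ U) := by
  simp only [Rel, cut_parts, List.mem_filter, List.mem_cons, List.not_mem_nil, or_false,
    decide_eq_true_eq]
  constructor
  · rintro ⟨p, ⟨rfl | rfl, -⟩, ha, hb⟩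
    · simp_all
    · simp_all
  · rintro ⟨ha, hb, hab⟩
    by_cases haU : a ∈ U
    · have hbU := hab.1 haU
      exact ⟨A ∩ U, ⟨Or.inl rfl, a, by simp [ha, haU]⟩, by simp [ha, haU], by simp [hb, hbU]⟩
    · have hbU : b ∉ U := fun h => haU (hab.2 h)
      exact ⟨A \ U, ⟨Or.inr rfl, a, by simp [ha, haU]⟩, by simp [ha, haU], by simp [hb, hbU]⟩

theorem refines_cut_iff {P : SetComposition A} {U : Finset ℕ} :
    P.Refines (cut A U) ↔ ∀ a b, P.Rel a b → a ∈ U → b ∈ U := by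
  rw [refines_iff_rel]
  constructor
  · exact fun h a b hab ha => (rel_cut.1 (h a b hab)).2.2.1 ha
  · exact fun h a b hab => rel_cut.2 ⟨hab.mem_left, hab.symm.mem_left, h a b hab, h b a hab.symm⟩

theorem interList_filter_right (L M : List (Finset ℕ)) :
    interList L (M.filter fun r => r.Nonempty) = interList L M := by
  induction L with
  | nil => rfl
  | cons p L ih => rw [interList_cons, interList_cons, ih, inter_filter_map]

/-- Both products equal (U, V∖U, A∖V) within A: the only product term whose position could differ is
U∖V, which is empty. -/
theorem cut_mul_cut_comm {U V : Finset ℕ} (h : U ⊆ V) :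
    cut A U * cut A V = cut A V * cut A U := by
  refine SetComposition.ext ?_
  have h1 : A ∩ U ∩ (A \ V) = ∅ := by
    ext a; simp only [Finset.mem_inter, Finset.mem_sdiff, Finset.notMem_empty]; tauto
  have h2 : A \ V ∩ (A ∩ U) = ∅ := by rw [Finset.inter_comm, h1]
  simp only [mul_parts, cut_parts, interList_filter, interList_filter_right, interList_cons,
    interList_nil, List.map_cons, List.map_nil, List.append_nil]
  rw [h1, h2, Finset.inter_comm (A ∩ V) (A ∩ U), Finset.inter_comm (A ∩ V) (A \ U),
    Finset.inter_comm (A \ V) (A \ U)]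
  simp only [List.filter_cons, List.filter_nil]
  split_ifs <;> simp_all

/-- Cutting along the union of an initial segment first lists the components of that segment and
then the others, so the order of S survives. -/
theorem cut_mul_eq_self {S : SetComposition A} {L M : List (Finset ℕ)} (h : S.parts = L ++ M) :
    cut A (L.toFinset.biUnion id) * S = S := by
  refine SetComposition.ext ?_
  have hd := S.disjoint
  rw [h, List.pairwise_append] at hd
  have hL : ∀ q ∈ L, q ⊆ A ∧ q.Nonempty := fun q hq =>
    ⟨S.subset_of_mem (by simp [h, hq]), S.nonempty q (by simp [h, hq])⟩
  have hM : ∀ q ∈ M, q ⊆ A ∧ q.Nonempty := fun q hq =>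
    ⟨S.subset_of_mem (by simp [h, hq]), S.nonempty q (by simp [h, hq])⟩
  rw [mul_parts, cut_parts, interList_filter, interList_cons, interList_cons, interList_nil, h,
    List.map_append, List.map_append, List.filter_append, List.filter_append, List.append_nil,
    filter_map_inter_eq_self (M := L), filter_map_inter_eq_nil (M := M),
    filter_map_inter_eq_nil (M := L), filter_map_inter_eq_self (M := M), List.append_nil,
    List.nil_append]
  · refine fun q hq => ⟨fun a ha => ?_, (hM q hq).2⟩
    simp only [Finset.mem_sdiff, Finset.mem_biUnion, List.mem_toFinset, id, not_exists, not_and]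
    exact ⟨(hM q hq).1 ha, fun p hp hap => Finset.disjoint_left.1 (hd.2.2 p hp q hq) hap ha⟩
  · refine fun q hq => Finset.disjoint_left.2 fun a ha haq => ?_
    exact (Finset.mem_sdiff.1 ha).2 (Finset.mem_biUnion.2 ⟨q, List.mem_toFinset.2 hq, haq⟩)
  · refine fun q hq => Finset.disjoint_left.2 fun a ha haq => ?_
    obtain ⟨p, hp, hap⟩ := Finset.mem_biUnion.1 (Finset.mem_inter.1 ha).2
    exact Finset.disjoint_left.1 (hd.2.2 p (List.mem_toFinset.1 hp) q hq) hap haq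
  · exact fun q hq => ⟨fun a ha => Finset.mem_inter.2 ⟨(hL q hq).1 ha,
      Finset.mem_biUnion.2 ⟨q, List.mem_toFinset.2 hq, ha⟩⟩, (hL q hq).2⟩

/-- Some a, b share a component of P but lie in distinct components s, t of S. An initial segment of
S that ends between s and t separates them. -/
theorem exists_cut_mul_eq_self {P S : SetComposition A} (h : ¬ P.Refines S) :
    ∃ U, cut A U * S = S ∧ ¬ P.Refines (cut A U) := by
  rw [refines_iff_rel] at h
  push Not at h
  obtain ⟨a, b, hab, hS⟩ := h
  obtain ⟨s, hs, has⟩ := (S.union a).1 hab.mem_left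
  obtain ⟨t, ht, hbt⟩ := (S.union b).1 hab.symm.mem_left
  have hts : t ≠ s := by
    rintro rfl
    exact hS ⟨t, ht, has, hbt⟩
  obtain ⟨L, M, hLM⟩ := List.append_of_mem hs
  have haL : ∀ p ∈ L, a ∉ p := fun p hp hap => by
    have hd := S.disjoint
    rw [hLM, List.pairwise_append] at hd
    exact Finset.disjoint_left.1 (hd.2.2 p hp s (by simp)) hap has
  by_cases htL : t ∈ L
  -- Here t precedes s: the segment before s contains b but not a. In the other case the segment
  -- ending with s contains a but not b.
  · refine ⟨_, cut_mul_eq_self hLM, fun hP => ?_⟩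
    obtain ⟨p, hp, hap⟩ := Finset.mem_biUnion.1 (refines_cut_iff.1 hP b a hab.symm
      (Finset.mem_biUnion.2 ⟨t, List.mem_toFinset.2 htL, hbt⟩))
    exact haL p (List.mem_toFinset.1 hp) hap
  · refine ⟨_, cut_mul_eq_self (L := L ++ [s]) (M := M) (by simp [hLM]), fun hP => ?_⟩
    obtain ⟨p, hp, hbp⟩ := Finset.mem_biUnion.1 (refines_cut_iff.1 hP a b hab
      (Finset.mem_biUnion.2 ⟨s, by simp, has⟩))
    have hpL : p ∈ L ++ [s] := List.mem_toFinset.1 hp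
    obtain rfl : p = t := S.eq_of_mem_of_mem (by
      rw [hLM]
      simp only [List.mem_append, List.mem_cons, List.not_mem_nil] at hpL ⊢
      tauto) ht hbp hbt
    simp_all

/-! ### The order of two elements in a product -/

/-- One of the components containing `x` precedes one of those containing `y`. -/
def Before (x y : ℕ) : List (Finset ℕ) → Prop
  | [] => False
  | p :: L => (x ∈ p ∧ ∃ q ∈ L, y ∈ q) ∨ Before x y L

theorem before_append {x y : ℕ} {L M : List (Finset ℕ)} :
    Before x y (L ++ M) ↔
      Before x y L ∨ Before x y M ∨ ((∃ p ∈ L, x ∈ p) ∧ ∃ q ∈ M, y ∈ q) := by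
  induction L with
  | nil => simp [Before]
  | cons p L ih =>
    simp only [List.cons_append, Before, ih, List.mem_append, List.mem_cons, or_and_right,
      exists_or, exists_eq_left]
    generalize Before x y L = r, Before x y M = s, (∃ q ∈ L, y ∈ q) = t
    generalize (∃ q ∈ M, y ∈ q) = u
    tauto

theorem before_filter {x y : ℕ} {L : List (Finset ℕ)} :
    Before x y (L.filter fun r => r.Nonempty) ↔ Before x y L := by
  induction L with
  | nil => rfl
  | cons p L ih =>
    by_cases hp : p.Nonempty
    · rw [List.filter_cons_of_pos (by simpa using hp)]
      simp only [Before, ih]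
      refine or_congr_left (and_congr_right fun _ => exists_congr fun q => ?_)
      simp only [List.mem_filter, decide_eq_true_eq]
      exact ⟨fun h => ⟨h.1.1, h.2⟩, fun h => ⟨⟨h.1, y, h.2⟩, h.2⟩⟩
    · rw [List.filter_cons_of_neg (by simpa using hp), ih]
      rw [Finset.not_nonempty_iff_eq_empty] at hp
      simp [Before, hp]

theorem before_map_inter {x y : ℕ} {p : Finset ℕ} {L : List (Finset ℕ)} :
    Before x y (L.map fun q => p ∩ q) ↔ (x ∈ p ∧ y ∈ p) ∧ Before x y L := by
  induction L with
  | nil => simp [Before]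
  | cons q L ih =>
    simp only [List.map_cons, Before, ih, List.mem_map, Finset.mem_inter, exists_exists_and_eq_and]
    grind

theorem before_interList {x y : ℕ} {L M : List (Finset ℕ)} (hx : ∃ q ∈ M, x ∈ q)
    (hy : ∃ q ∈ M, y ∈ q) :
    Before x y (interList L M) ↔
      Before x y L ∨ ((∃ p ∈ L, x ∈ p ∧ y ∈ p) ∧ Before x y M) := by
  induction L with
  | nil => simp [interList_nil, Before]
  | cons p L ih =>
    have h1 : (∃ r ∈ (M.map fun q => p ∩ q).filter (fun r => r.Nonempty), x ∈ r) ↔ x ∈ p := by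
      simp only [List.mem_filter, List.mem_map, decide_eq_true_eq]
      constructor
      · rintro ⟨r, ⟨⟨q, -, rfl⟩, -⟩, h⟩
        exact (Finset.mem_inter.1 h).1
      · intro h
        obtain ⟨q, hq, hxq⟩ := hx
        exact ⟨p ∩ q, ⟨⟨q, hq, rfl⟩, x, by simp [h, hxq]⟩, by simp [h, hxq]⟩
    have h2 : (∃ r ∈ interList L M, y ∈ r) ↔ ∃ q ∈ L, y ∈ q := by
      simp only [mem_interList]
      constructor
      · rintro ⟨r, ⟨⟨q, hq, q', -, rfl⟩, -⟩, h⟩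
        exact ⟨q, hq, (Finset.mem_inter.1 h).1⟩
      · rintro ⟨q', hq', h⟩
        obtain ⟨q, hq, hyq⟩ := hy
        exact ⟨q' ∩ q, ⟨⟨q', hq', q, hq, rfl⟩, y, by simp [h, hyq]⟩, by simp [h, hyq]⟩
    rw [interList_cons, before_append, h1, h2, ih, before_filter, before_map_inter]
    simp only [Before, List.mem_cons, or_and_right, exists_or, exists_eq_left]
    generalize Before x y L = r, Before x y M = s, (∃ q ∈ L, y ∈ q) = t
    generalize (∃ q ∈ L, x ∈ q ∧ y ∈ q) = u
    clear hx hy h1 h2 ih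
    grind

theorem Before.exists_disjoint {x y : ℕ} {L : List (Finset ℕ)} (hL : L.Pairwise Disjoint)
    (h : Before x y L) : ∃ p ∈ L, ∃ q ∈ L, Disjoint p q ∧ x ∈ p ∧ y ∈ q := by
  induction L with
  | nil => exact h.elim
  | cons p L ih =>
    rw [List.pairwise_cons] at hL
    rcases h with ⟨hx, q, hq, hy⟩ | h
    · exact ⟨p, by simp, q, by simp [hq], hL.1 q hq, hx, hy⟩
    · obtain ⟨p', hp', q', hq', h⟩ := ih hL.2 h
      exact ⟨p', by simp [hp'], q', by simp [hq'], h⟩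

theorem not_before_of_rel {S : SetComposition A} {x y : ℕ} (h : S.Rel x y) :
    ¬ Before x y S.parts := fun hb => by
  obtain ⟨p, hp, q, hq, hpq, hx, hy⟩ := hb.exists_disjoint S.disjoint
  exact Finset.disjoint_left.1 hpq ((rel_iff_mem hp hx).1 h) hy

/-- The product orders lexicographically: S decides only between elements that R leaves together.
This is the source of the derivation rule for `orderFun`. -/
theorem before_mul {R S : SetComposition A} {x y : ℕ} (hx : x ∈ A) (hy : y ∈ A) :
    Before x y (R * S).parts ↔ Before x y R.parts ∨ (R.Rel x y ∧ Before x y S.parts) := by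
  rw [mul_parts, before_interList ((S.union x).1 hx) ((S.union y).1 hy)]
  rfl

theorem before_cut_iff {U : Finset ℕ} {x y : ℕ} (hx : x ∈ A) (hy : y ∈ A) :
    Before x y (cut A U).parts ↔ x ∈ U ∧ y ∉ U := by
  rw [cut_parts, before_filter]
  simp [Before, hx, hy]

/-! ### The support lattice -/

theorem support_le_support_iff {P Q : SetComposition A} :
    P.support ≤ Q.support ↔ P.Refines Q := by
  change (∀ b, b ∈ P.parts.toFinset → ∃ c ∈ Q.parts.toFinset, b ≤ c) ↔ _
  simp [Refines]

theorem support_surjective :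
    Function.Surjective (SetComposition.support : SetComposition A → Finpartition A) := by
  intro π
  refine ⟨⟨π.parts.toList, fun p hp => π.nonempty_of_mem_parts (Finset.mem_toList.1 hp), ?_,
    fun a => ?_⟩, ?_⟩
  · refine (Finset.nodup_toList _).imp_of_mem ?_
    exact fun hp hq hne => π.disjoint (Finset.mem_toList.1 hp) (Finset.mem_toList.1 hq) hne
  · constructor
    · intro ha
      obtain ⟨t, ht, hat⟩ := π.exists_mem ha
      exact ⟨t, Finset.mem_toList.2 ht, hat⟩
    · rintro ⟨t, ht, hat⟩
      exact π.le (Finset.mem_toList.1 ht) hat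
  · ext : 1
    exact Finset.toList_toFinset _

theorem isSupportLattice_support :
    IsSupportLattice (SetComposition.support : SetComposition A → Finpartition A) where
  exists_isLUB := fun a b => by
    classical
    -- There are finitely many partitions, so the join is the meet of all common upper bounds.
    let T : Finset (Finpartition A) := Finset.univ.filter fun c => a ≤ c ∧ b ≤ c
    refine ⟨T.inf id, ?_, ?_⟩
    · rintro x (rfl | rfl)
      · exact Finset.le_inf fun c hc => (Finset.mem_filter.1 hc).2.1
      · exact Finset.le_inf fun c hc => (Finset.mem_filter.1 hc).2.2
    · intro c hc
      exact Finset.inf_le (f := id)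
        (Finset.mem_filter.2 ⟨Finset.mem_univ c, hc (by simp), hc (by simp)⟩)
  exists_isGLB := fun a b => ⟨a ⊓ b, isGLB_pair⟩
  surjective := support_surjective
  isGLB_mul := fun P Q => by
    constructor
    · rintro x (rfl | rfl)
      · exact support_le_support_iff.2 (mul_refines_left P Q)
      · exact support_le_support_iff.2 (mul_refines_right P Q)
    · intro c hc
      obtain ⟨R, rfl⟩ := support_surjective c
      exact support_le_support_iff.2 ((refines_mul_iff _ _ _).2
        ⟨support_le_support_iff.1 (hc (by simp)), support_le_support_iff.1 (hc (by simp))⟩)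
  le_iff := fun P Q => by
    rw [mul_mul_cancel, support_le_support_iff, ← mul_eq_left_iff, eq_comm]

end SetComposition

/-! ### Covering relations between set partitions -/

namespace Finpartition

variable {A : Finset ℕ}

theorem union_notMem_parts (π : Finpartition A) {b c : Finset ℕ} (hb : b ∈ π.parts)
    (hc : c ∈ π.parts) (hbc : b ≠ c) : b ∪ c ∉ π.parts := fun h => by
  obtain ⟨x, hx⟩ := π.nonempty_of_mem_parts hb
  obtain ⟨y, hy⟩ := π.nonempty_of_mem_parts hc
  exact hbc ((π.eq_of_mem_parts hb h hx (Finset.mem_union_left _ hx)).trans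
    (π.eq_of_mem_parts hc h hy (Finset.mem_union_right _ hy)).symm)

theorem exists_parts_eq_merge (π : Finpartition A) {b c : Finset ℕ} (hb : b ∈ π.parts)
    (hc : c ∈ π.parts) :
    ∃ σ : Finpartition A, σ.parts = insert (b ∪ c) ((π.parts.erase b).erase c) := by
  refine ⟨ofExistsUnique (insert (b ∪ c) ((π.parts.erase b).erase c)) ?_ ?_ ?_, rfl⟩
  · intro p hp
    rcases Finset.mem_insert.1 hp with rfl | hp
    · exact Finset.union_subset (π.le hb) (π.le hc)
    · exact π.le (Finset.mem_of_mem_erase (Finset.mem_of_mem_erase hp))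
  · intro a ha
    obtain ⟨t, ht, hat⟩ := π.exists_mem ha
    by_cases htbc : t = b ∨ t = c
    · refine ⟨b ∪ c, ⟨by simp, by rcases htbc with rfl | rfl <;> simp [hat]⟩, ?_⟩
      rintro s ⟨hs, has⟩
      rcases Finset.mem_insert.1 hs with rfl | hs
      · rfl
      · simp only [Finset.mem_erase] at hs
        obtain rfl := π.eq_of_mem_parts hs.2.2 ht has hat
        tauto
    · push Not at htbc
      refine ⟨t, ⟨by simp [htbc, ht], hat⟩, ?_⟩
      rintro s ⟨hs, has⟩
      rcases Finset.mem_insert.1 hs with rfl | hs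
      · rcases Finset.mem_union.1 has with has | has
        · exact absurd (π.eq_of_mem_parts ht hb hat has) htbc.1
        · exact absurd (π.eq_of_mem_parts ht hc hat has) htbc.2
      · simp only [Finset.mem_erase] at hs
        exact π.eq_of_mem_parts hs.2.2 ht has hat
  · intro h
    rcases Finset.mem_insert.1 h with h | h
    · exact π.ne_empty hb (Finset.union_eq_empty.1 h.symm).1
    · exact π.empty_notMem_parts (Finset.mem_of_mem_erase (Finset.mem_of_mem_erase h))

theorem card_parts_merge {π σ : Finpartition A} {b c : Finset ℕ} (hb : b ∈ π.parts)
    (hc : c ∈ π.parts) (hbc : b ≠ c)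
    (hσ : σ.parts = insert (b ∪ c) ((π.parts.erase b).erase c)) :
    σ.parts.card + 1 = π.parts.card := by
  rw [hσ, Finset.card_insert_of_notMem fun h => π.union_notMem_parts hb hc hbc
    (Finset.mem_of_mem_erase (Finset.mem_of_mem_erase h)),
    Finset.card_erase_add_one (Finset.mem_erase.2 ⟨hbc.symm, hc⟩), Finset.card_erase_add_one hb]

theorem le_merge {π σ : Finpartition A} {b c : Finset ℕ}
    (hσ : σ.parts = insert (b ∪ c) ((π.parts.erase b).erase c)) : π ≤ σ := by
  intro t ht
  rw [hσ]
  by_cases htb : t = b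
  · exact ⟨b ∪ c, by simp, by simp [htb]⟩
  by_cases htc : t = c
  · exact ⟨b ∪ c, by simp, by simp [htc]⟩
  exact ⟨t, by simp [htb, htc, ht], le_rfl⟩

theorem merge_le {π σ ρ : Finpartition A} {b c r : Finset ℕ}
    (hσ : σ.parts = insert (b ∪ c) ((π.parts.erase b).erase c)) (h : π ≤ ρ)
    (hr : r ∈ ρ.parts) (hbr : b ⊆ r) (hcr : c ⊆ r) : σ ≤ ρ := by
  intro t ht
  rw [hσ, Finset.mem_insert] at ht
  rcases ht with rfl | ht
  · exact ⟨r, hr, Finset.union_subset hbr hcr⟩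
  · exact h (Finset.mem_of_mem_erase (Finset.mem_of_mem_erase ht))

/-- Some part r of ρ is contained in no part of π, yet is a union of parts of π; hence it contains
at least two. -/
theorem exists_ne_subset_of_lt {π ρ : Finpartition A} (h : π < ρ) :
    ∃ b ∈ π.parts, ∃ c ∈ π.parts, ∃ r ∈ ρ.parts, b ≠ c ∧ b ⊆ r ∧ c ⊆ r := by
  have hnot : ¬ ∀ r, r ∈ ρ.parts → ∃ b ∈ π.parts, r ≤ b := h.not_ge
  push Not at hnot
  obtain ⟨r, hr, hrb⟩ := hnot
  have hsub : ∀ a ∈ r, ∀ b ∈ π.parts, a ∈ b → b ⊆ r := fun a ha b hb hab => by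
    obtain ⟨s, hs, hbs⟩ := h.le hb
    rwa [ρ.eq_of_mem_parts hr hs ha (hbs hab)]
  obtain ⟨a, ha⟩ := ρ.nonempty_of_mem_parts hr
  obtain ⟨b, hb, hab⟩ := π.exists_mem (ρ.le hr ha)
  obtain ⟨a', ha', hab'⟩ := Finset.not_subset.1 (hrb b hb)
  obtain ⟨c, hc, hac⟩ := π.exists_mem (ρ.le hr ha')
  refine ⟨b, hb, c, hc, r, hr, ?_, hsub a ha b hb hab, hsub a' ha' c hc hac⟩
  rintro rfl
  exact hab' hac

theorem card_parts_lt_of_lt {π ρ : Finpartition A} (h : π < ρ) :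
    ρ.parts.card < π.parts.card := by
  obtain ⟨b, hb, c, hc, r, hr, hbc, hbr, hcr⟩ := exists_ne_subset_of_lt h
  obtain ⟨σ, hσ⟩ := π.exists_parts_eq_merge hb hc
  have h1 := card_mono (merge_le hσ h.le hr hbr hcr)
  have h2 := card_parts_merge hb hc hbc hσ
  omega

/-- A partition covers another one exactly if it arises from it by merging two parts. -/
theorem exists_merge_of_covBy {π ρ : Finpartition A} (h : π ⋖ ρ) :
    ∃ b ∈ π.parts, ∃ c ∈ π.parts, b ≠ c ∧
      ρ.parts = insert (b ∪ c) ((π.parts.erase b).erase c) := by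
  obtain ⟨b, hb, c, hc, r, hr, hbc, hbr, hcr⟩ := exists_ne_subset_of_lt h.lt
  obtain ⟨σ, hσ⟩ := π.exists_parts_eq_merge hb hc
  refine ⟨b, hb, c, hc, hbc, ?_⟩
  have hσρ := merge_le hσ h.le hr hbr hcr
  have h2 := card_parts_merge hb hc hbc hσ
  rcases eq_or_lt_of_le hσρ with rfl | hlt
  · exact hσ
  · refine absurd hlt (h.2 (lt_of_le_of_ne (le_merge hσ) ?_))
    rintro rfl
    omega

theorem covBy_iff_card_parts {π ρ : Finpartition A} :
    π ⋖ ρ ↔ π ≤ ρ ∧ π.parts.card = ρ.parts.card + 1 := by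
  constructor
  · intro h
    obtain ⟨b, hb, c, hc, hbc, hρ⟩ := exists_merge_of_covBy h
    exact ⟨h.le, (card_parts_merge hb hc hbc hρ).symm⟩
  · rintro ⟨hle, hcard⟩
    refine ⟨lt_of_le_of_ne hle ?_, fun σ h1 h2 => ?_⟩
    · rintro rfl
      omega
    · have := card_parts_lt_of_lt h1
      have := card_parts_lt_of_lt h2
      omega

/-- Merging b and c alone stays strictly below ρ, so two distinct parts of the merged partition lie
in a common part of ρ. One of the two is not b ∪ c and serves as e. -/
theorem exists_third_part_of_not_covBy {π ρ : Finpartition A} (h : π ≤ ρ) (hcov : ¬ π ⋖ ρ)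
    {b c r : Finset ℕ} (hb : b ∈ π.parts) (hc : c ∈ π.parts) (hbc : b ≠ c) (hr : r ∈ ρ.parts)
    (hbr : b ⊆ r) (hcr : c ⊆ r) :
    ∃ e ∈ π.parts, e ≠ b ∧ e ≠ c ∧ ∃ s ∈ ρ.parts, e ⊂ s := by
  obtain ⟨σ, hσ⟩ := π.exists_parts_eq_merge hb hc
  have hσρ : σ < ρ := by
    refine lt_of_le_of_ne (merge_le hσ h hr hbr hcr) ?_
    rintro rfl
    exact hcov (covBy_iff_card_parts.2 ⟨h, (card_parts_merge hb hc hbc hσ).symm⟩)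
  obtain ⟨x, hx, y, hy, s, hs, hxy, hxs, hys⟩ := exists_ne_subset_of_lt hσρ
  have key : ∀ x ∈ σ.parts, ∀ y ∈ σ.parts, x ≠ y → x ⊆ s → y ⊆ s → x ≠ b ∪ c →
      ∃ e ∈ π.parts, e ≠ b ∧ e ≠ c ∧ ∃ s ∈ ρ.parts, e ⊂ s := by
    intro x hx y hy hxy hxs hys hxbc
    have hx' := hx
    rw [hσ, Finset.mem_insert, Finset.mem_erase, Finset.mem_erase] at hx'
    obtain ⟨hxc, hxb, hxπ⟩ := hx'.resolve_left hxbc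
    refine ⟨x, hxπ, hxb, hxc, s, hs, hxs, fun hsx => ?_⟩
    obtain ⟨z, hz⟩ := σ.nonempty_of_mem_parts hy
    exact hxy (σ.eq_of_mem_parts hx hy (hsx (hys hz)) hz)
  by_cases hxbc : x = b ∪ c
  · exact key y hy x hx hxy.symm hys hxs (hxbc ▸ hxy.symm)
  · exact key x hx y hy hxy hxs hys hxbc

end Finpartition

/-! ### Skew derivations on the monoid of set compositions -/

namespace SetComposition

variable {A : Finset ℕ} {F : Type u} [Field F]

theorem character_apply_of_refines {P R : SetComposition A} (h : P.Refines R) :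
    P.character F R = 1 := if_pos h

theorem character_apply_of_not_refines {P R : SetComposition A} (h : ¬ P.Refines R) :
    P.character F R = 0 := if_neg h

theorem mem_support_parts {P : SetComposition A} {p : Finset ℕ} :
    p ∈ P.support.parts ↔ p ∈ P.parts := List.mem_toFinset

theorem nodup_parts (P : SetComposition A) : P.parts.Nodup := by
  refine P.disjoint.imp_of_mem fun {p q} hp _ hpq hne => ?_
  subst hne
  obtain ⟨a, ha⟩ := P.nonempty p hp
  exact Finset.disjoint_left.1 hpq ha ha

theorem card_support_parts (P : SetComposition A) : P.support.parts.card = P.length :=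
  List.toFinset_card_of_nodup P.nodup_parts

theorem support_covBy_support_iff {P Q : SetComposition A} :
    Q.support ⋖ P.support ↔ Q.Refines P ∧ Q.length = P.length + 1 := by
  rw [Finpartition.covBy_iff_card_parts, support_le_support_iff, card_support_parts,
    card_support_parts]

/-- A function on the monoid of set compositions that is a skew derivation with respect to the
characters belonging to `P` and `Q`. -/
def IsSkew (P Q : SetComposition A) (δ : SetComposition A → F) : Prop :=
  ∀ R S, δ (R * S) = P.character F R * δ S + δ R * Q.character F S

section IsSkew

variable {P Q : SetComposition A} {δ : SetComposition A → F}

/-- Applied to RR = R, the rule reads δ(R) = 2δ(R) if both characters are 1 and δ(R) = 0 if both are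
0, so the characteristic plays no role. -/
theorem IsSkew.apply_eq_zero (hδ : IsSkew P Q δ) {R : SetComposition A}
    (h : P.Refines R ↔ Q.Refines R) : δ R = 0 := by
  have h1 := hδ R R
  rw [mul_self] at h1
  by_cases hR : P.Refines R
  · rw [character_apply_of_refines hR, character_apply_of_refines (h.1 hR)] at h1
    simpa using h1
  · rw [character_apply_of_not_refines hR, character_apply_of_not_refines (mt h.2 hR)] at h1
    simpa using h1

theorem IsSkew.mul_right (hδ : IsSkew P Q δ) {R S : SetComposition A} (hR : ¬ P.Refines R)
    (hS : Q.Refines S) : δ (R * S) = δ R := by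
  rw [hδ, character_apply_of_not_refines hR, character_apply_of_refines hS]
  simp

/-- Expand both sides of δ(PSP) = δ(PS), using χ_Q(P) = 0 and χ_P(P) = 1. -/
theorem IsSkew.eq_of_not_refines (hδ : IsSkew P Q δ) (h : ¬ Q.Refines P) (S : SetComposition A) :
    δ S = δ P * (P.character F S - Q.character F S) := by
  have h1 := hδ P S
  have h2 := hδ (P * S) P
  rw [mul_mul_cancel, h1, character_apply_of_not_refines h, map_mul,
    character_apply_of_refines (Refines.refl P)] at h2
  linear_combination h2

theorem IsSkew.cut_eq_cut (hδ : IsSkew P Q δ) {U V : Finset ℕ} (hUV : U ⊆ V)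
    (hU : ¬ P.Refines (cut A U)) (hV : ¬ P.Refines (cut A V)) (hU' : Q.Refines (cut A U))
    (hV' : Q.Refines (cut A V)) : δ (cut A U) = δ (cut A V) := by
  rw [← hδ.mul_right hU hV', cut_mul_cut_comm hUV, hδ.mul_right hV hU']

theorem refines_cut_of_mem {b : Finset ℕ} (hb : b ∈ Q.parts) : Q.Refines (cut A b) :=
  refines_cut_iff.2 fun _ _ h ha => (rel_iff_mem hb ha).1 h

/-- The component b is chosen before δ, so that the same b serves to compare two skew derivations at
S. -/
theorem exists_part_forall_isSkew_eq (P : SetComposition A) {S : SetComposition A}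
    (hQ : Q.Refines S) (hP : ¬ P.Refines S) :
    ∃ b ∈ Q.parts, ¬ P.Refines (cut A b) ∧
      ∀ δ : SetComposition A → F, IsSkew P Q δ → δ S = δ (cut A b) := by
  obtain ⟨U, hUS, hU⟩ := exists_cut_mul_eq_self hP
  have hQU : Q.Refines (cut A U) := ((refines_mul_iff _ _ _).1 (hUS.symm ▸ hQ)).1
  have hU' := hU
  rw [refines_cut_iff] at hU'
  push Not at hU'
  obtain ⟨a, a', haa', ha, ha'⟩ := hU'
  obtain ⟨b, hb, hab⟩ := (Q.union a).1 haa'.mem_left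
  have hbU : b ⊆ U := fun x hx => refines_cut_iff.1 hQU a x ((rel_iff_mem hb hab).2 hx) ha
  have hPb : ¬ P.Refines (cut A b) := fun h =>
    ha' (hbU (refines_cut_iff.1 h a a' haa' hab))
  refine ⟨b, hb, hPb, fun δ hδ => ?_⟩
  rw [hδ.cut_eq_cut hbU hPb hU (refines_cut_of_mem hb) hQU, ← hδ.mul_right hU hQ, hUS]

theorem IsSkew.cut_eq_cut_of_not_covBy (hδ : IsSkew P Q δ) (hQP : Q.Refines P)
    (hcov : ¬ Q.support ⋖ P.support) {b c : Finset ℕ} (hb : b ∈ Q.parts) (hc : c ∈ Q.parts)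
    (hPb : ¬ P.Refines (cut A b)) (hPc : ¬ P.Refines (cut A c)) :
    δ (cut A b) = δ (cut A c) := by
  -- If b ∪ c is not a union of components of P, the cut along b ∪ c contains both smaller cuts and
  -- transports the value from one to the other.
  have pair : ∀ {b c : Finset ℕ}, b ∈ Q.parts → c ∈ Q.parts → ¬ P.Refines (cut A b) →
      ¬ P.Refines (cut A c) → ∀ {a a' : ℕ}, P.Rel a a' → a ∈ b ∪ c → a' ∉ b ∪ c →
      δ (cut A b) = δ (cut A c) := by
    intro b c hb hc hPb hPc a a' haa' ha ha'
    have hP : ¬ P.Refines (cut A (b ∪ c)) := fun h => ha' (refines_cut_iff.1 h a a' haa' ha)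
    have hQ : Q.Refines (cut A (b ∪ c)) := refines_cut_iff.2 fun x y hxy hx => by
      rcases Finset.mem_union.1 hx with hx | hx
      · exact Finset.mem_union_left _ ((rel_iff_mem hb hx).1 hxy)
      · exact Finset.mem_union_right _ ((rel_iff_mem hc hx).1 hxy)
    rw [hδ.cut_eq_cut Finset.subset_union_left hPb hP (refines_cut_of_mem hb) hQ,
      hδ.cut_eq_cut Finset.subset_union_right hPc hP (refines_cut_of_mem hc) hQ]
  rcases eq_or_ne b c with rfl | hbc
  · rfl
  by_cases hrel : ∃ x ∈ b, ∃ y ∈ c, P.Rel x y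
  · obtain ⟨x, hx, y, hy, r, hr, hxr, hyr⟩ := hrel
    have hsub : ∀ q ∈ Q.parts, ∀ z ∈ q, z ∈ r → q ⊆ r := fun q hq z hz hzr => by
      obtain ⟨s, hs, hqs⟩ := hQP q hq
      rwa [P.eq_of_mem_of_mem hr hs hzr (hqs hz)]
    -- When b and c lie in the same component of P, their union may be that whole component and
    -- `pair` may fail directly. A third component e helps: b ∪ e and c ∪ e each separate x from y.
    obtain ⟨e, he, heb, hec, s, hs, hes⟩ := Finpartition.exists_third_part_of_not_covBy
      (support_le_support_iff.2 hQP) hcov (mem_support_parts.2 hb) (mem_support_parts.2 hc) hbc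
      (mem_support_parts.2 hr) (hsub b hb x hx hxr) (hsub c hc y hy hyr)
    rw [mem_support_parts] at he hs
    have hPe : ¬ P.Refines (cut A e) := fun h => by
      obtain ⟨z, hz⟩ := Q.nonempty e he
      exact hes.2 fun z' hz' => refines_cut_iff.1 h z z' ⟨s, hs, hes.1 hz, hz'⟩ hz
    have hnot : ∀ {p q : Finset ℕ} {z : ℕ}, p ∈ Q.parts → q ∈ Q.parts → p ≠ q → z ∈ p → z ∉ q :=
      fun hp hq hpq hzp hzq => hpq (Q.eq_of_mem_of_mem hp hq hzp hzq)
    rw [pair hb he hPb hPe (a := x) (a' := y) ⟨r, hr, hxr, hyr⟩ (by simp [hx])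
        (by simp [hnot hc hb hbc.symm hy, hnot hc he hec.symm hy]),
      pair hc he hPc hPe (a := y) (a' := x) ⟨r, hr, hyr, hxr⟩ (by simp [hy])
        (by simp [hnot hb hc hbc hx, hnot hb he heb.symm hx])]
  · push Not at hrel
    have hPb' := hPb
    rw [refines_cut_iff] at hPb'
    push Not at hPb'
    obtain ⟨a, a', haa', ha, ha'⟩ := hPb'
    refine pair hb hc hPb hPc haa' (by simp [ha]) ?_
    rw [Finset.mem_union, not_or]
    exact ⟨ha', fun h => hrel a ha a' h haa'⟩

theorem IsSkew.exists_eq_of_not_covBy (hδ : IsSkew P Q δ) (hcov : ¬ Q.support ⋖ P.support) :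
    ∃ c : F, ∀ R, δ R = c * (P.character F R - Q.character F R) := by
  by_cases hQP : Q.Refines P
  swap
  · exact ⟨_, hδ.eq_of_not_refines hQP⟩
  by_cases hex : ∃ b ∈ Q.parts, ¬ P.Refines (cut A b)
  · obtain ⟨b, hb, hPb⟩ := hex
    -- At a composition refined by Q but not by P, χ_P − χ_Q is −1.
    refine ⟨-δ (cut A b), fun R => ?_⟩
    by_cases hP : P.Refines R
    · rw [hδ.apply_eq_zero (iff_of_true hP (hQP.trans hP)), character_apply_of_refines hP,
        character_apply_of_refines (hQP.trans hP), sub_self, mul_zero]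
    by_cases hQ : Q.Refines R
    · obtain ⟨c, hc, hPc, h⟩ := exists_part_forall_isSkew_eq (F := F) P hQ hP
      rw [h δ hδ, character_apply_of_refines hQ, character_apply_of_not_refines hP,
        hδ.cut_eq_cut_of_not_covBy hQP hcov hc hb hPc hPb]
      ring
    · rw [hδ.apply_eq_zero (iff_of_false hP hQ), character_apply_of_not_refines hP,
        character_apply_of_not_refines hQ, sub_self, mul_zero]
  · push Not at hex
    refine ⟨0, fun R => ?_⟩
    rw [zero_mul]
    refine hδ.apply_eq_zero ⟨hQP.trans, fun hQ => ?_⟩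
    by_contra hP
    obtain ⟨c, hc, hPc, -⟩ := exists_part_forall_isSkew_eq (F := F) P hQ hP
    exact hPc (hex c hc)

open Classical in
/-- The function that tells whether the component containing `x` precedes the one containing `y`,
restricted to the set compositions that `Q` refines. -/
noncomputable def orderFun (F : Type u) [Field F] (Q : SetComposition A) (x y : ℕ)
    (R : SetComposition A) : F :=
  if Q.Refines R ∧ Before x y R.parts then 1 else 0

/-- If `P` covers `Q`, there are components `b`, `c` of `Q` such that all skew derivations are
combinations of a non-inner one and an inner one. -/
theorem exists_isSkew_of_covBy (F : Type u) [Field F] {P Q : SetComposition A}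
    (hcov : Q.support ⋖ P.support) :
    ∃ δ₀ : SetComposition A → F, IsSkew P Q δ₀ ∧
      (¬ ∃ c : F, ∀ R, δ₀ R = c * (P.character F R - Q.character F R)) ∧
      ∀ δ : SetComposition A → F, IsSkew P Q δ →
        ∃ a c : F, ∀ R, δ R = a * δ₀ R + c * (P.character F R - Q.character F R) := by
  have hQP : Q.Refines P := support_le_support_iff.1 hcov.le
  obtain ⟨b, hb, c, hc, hbc, hparts⟩ := Finpartition.exists_merge_of_covBy hcov
  have hP : ∀ p, p ∈ P.parts ↔ p = b ∪ c ∨ (p ≠ c ∧ p ≠ b ∧ p ∈ Q.parts) := fun p => by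
    rw [← mem_support_parts, hparts, Finset.mem_insert, Finset.mem_erase, Finset.mem_erase,
      mem_support_parts]
  rw [mem_support_parts] at hb hc
  obtain ⟨x, hx⟩ := Q.nonempty b hb
  obtain ⟨y, hy⟩ := Q.nonempty c hc
  have hxA := Q.subset_of_mem hb hx
  have hyA := Q.subset_of_mem hc hy
  have hxc : x ∉ c := fun h => hbc (Q.eq_of_mem_of_mem hb hc hx h)
  have hyb : y ∉ b := fun h => hbc (Q.eq_of_mem_of_mem hb hc h hy)
  have hxy : P.Rel x y := ⟨b ∪ c, (hP _).2 (Or.inl rfl), by simp [hx], by simp [hy]⟩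
  -- Since P only merges b and c, a composition refined by Q is refined by P as soon as it keeps one
  -- x of b together with one y of c.
  have hrefines : ∀ R, Q.Refines R → (P.Refines R ↔ R.Rel x y) := fun R hR => by
    refine ⟨fun h => refines_iff_rel.1 h x y hxy, ?_⟩
    rintro ⟨s, hs, hxs, hys⟩ p hp
    rcases (hP p).1 hp with rfl | ⟨-, -, hp⟩
    · obtain ⟨t, ht, hbt⟩ := hR b hb
      obtain ⟨t', ht', hct⟩ := hR c hc
      obtain rfl := R.eq_of_mem_of_mem hs ht hxs (hbt hx)
      obtain rfl := R.eq_of_mem_of_mem hs ht' hys (hct hy)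
      exact ⟨s, hs, Finset.union_subset hbt hct⟩
    · exact hR p hp
  have hPb : ¬ P.Refines (cut A b) := fun h => hyb (refines_cut_iff.1 h x y hxy hx)
  have hPc : ¬ P.Refines (cut A c) := fun h => hxc (refines_cut_iff.1 h y x hxy.symm hy)
  have hQb := refines_cut_of_mem (A := A) hb
  have hQc := refines_cut_of_mem (A := A) hc
  have hδb : orderFun F Q x y (cut A b) = 1 :=
    if_pos ⟨hQb, (before_cut_iff hxA hyA).2 ⟨hx, hyb⟩⟩
  have hδc : orderFun F Q x y (cut A c) = 0 :=
    if_neg fun h => hxc ((before_cut_iff hxA hyA).1 h.2).1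
  have hδ₀ : IsSkew P Q (orderFun F Q x y) := fun R S => by
    classical
    have hmul : orderFun F Q x y (R * S) = if (Q.Refines R ∧ Q.Refines S) ∧
        (Before x y R.parts ∨ R.Rel x y ∧ Before x y S.parts) then 1 else 0 :=
      if_congr (and_congr (refines_mul_iff _ _ _) (before_mul hxA hyA)) rfl rfl
    rw [hmul]
    simp only [orderFun]
    by_cases hR : Q.Refines R
    swap
    · rw [character_apply_of_not_refines fun h => hR (hQP.trans h)]
      simp [hR]
    by_cases hS : Q.Refines S
    swap
    · rw [character_apply_of_not_refines hS]
      simp [hS]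
    by_cases hPR : P.Refines R
    · have hrel := (hrefines R hR).1 hPR
      have hnb := not_before_of_rel hrel
      rw [character_apply_of_refines hPR]
      simp [hR, hS, hrel, hnb]
    · have hrel := mt (hrefines R hR).2 hPR
      rw [character_apply_of_not_refines hPR, character_apply_of_refines hS]
      simp [hR, hS, hrel]
  refine ⟨orderFun F Q x y, hδ₀, ?_, fun δ hδ => ?_⟩
  -- An inner function takes the same value −k at both cuts, whereas `orderFun` takes 1 and 0.
  · rintro ⟨k, hk⟩
    have h1 := hk (cut A b)
    have h2 := hk (cut A c)
    rw [hδb, character_apply_of_refines hQb, character_apply_of_not_refines hPb] at h1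
    rw [hδc, character_apply_of_refines hQc, character_apply_of_not_refines hPc, ← h1] at h2
    exact zero_ne_one h2
  -- The values of `orderFun` at the cuts along b and c are 1 and 0, those of χ_P − χ_Q are −1 and
  -- −1; these coefficients solve the resulting two equations.
  · refine ⟨δ (cut A b) - δ (cut A c), -δ (cut A c), fun R => ?_⟩
    by_cases hPR : P.Refines R
    · rw [hδ.apply_eq_zero (iff_of_true hPR (hQP.trans hPR)),
        hδ₀.apply_eq_zero (iff_of_true hPR (hQP.trans hPR)), character_apply_of_refines hPR,
        character_apply_of_refines (hQP.trans hPR), sub_self, mul_zero, mul_zero, add_zero]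
    by_cases hQR : Q.Refines R
    · obtain ⟨e, he, hPe, h⟩ := exists_part_forall_isSkew_eq (F := F) P hQR hPR
      rw [h δ hδ, h _ hδ₀, character_apply_of_refines hQR, character_apply_of_not_refines hPR]
      have hebc : e = b ∨ e = c := by
        by_contra hne
        push Not at hne
        exact hPe (refines_cut_of_mem ((hP e).2 (Or.inr ⟨hne.2, hne.1, he⟩)))
      rcases hebc with rfl | rfl
      · rw [hδb]
        ring
      · rw [hδc]
        ring
    · rw [hδ.apply_eq_zero (iff_of_false hPR hQR), hδ₀.apply_eq_zero (iff_of_false hPR hQR),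
        character_apply_of_not_refines hPR, character_apply_of_not_refines hQR, sub_self, mul_zero,
        mul_zero, add_zero]

end IsSkew

/-! ### Passage to the Solomon-Tits algebra -/

/-- The linear extension of a function on set compositions to the Solomon-Tits algebra. -/
noncomputable def linearExtension (δ : SetComposition A → F) : SolomonTits F A →ₗ[F] F :=
  Finsupp.linearCombination F δ ∘ₗ (MonoidAlgebra.coeffLinearEquiv F).toLinearMap

theorem linearExtension_single (δ : SetComposition A → F) (R : SetComposition A) (c : F) :
    linearExtension δ (MonoidAlgebra.single R c) = c * δ R :=
  Finsupp.linearCombination_single F c R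

theorem characterHom_single (P R : SetComposition A) (c : F) :
    P.characterHom F (MonoidAlgebra.single R c) = c * P.character F R :=
  MonoidAlgebra.lift_single _ _ _

theorem linearMap_single (d : SolomonTits F A →ₗ[F] F) (R : SetComposition A) (c : F) :
    d (MonoidAlgebra.single R c) = c * d (MonoidAlgebra.single R 1) := by
  rw [← smul_eq_mul, ← map_smul, MonoidAlgebra.smul_single, smul_eq_mul, mul_one]

theorem isSkewDerivation_iff {P Q : SetComposition A} {d : SolomonTits F A →ₗ[F] F} :
    IsSkewDerivation (P.characterHom F) (Q.characterHom F) d ↔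
      IsSkew P Q fun R => d (MonoidAlgebra.single R 1) := by
  constructor
  · intro h R S
    have := h (MonoidAlgebra.single R 1) (MonoidAlgebra.single S 1)
    rwa [MonoidAlgebra.single_mul_single, characterHom_single, characterHom_single, one_mul,
      one_mul, one_mul] at this
  · intro h r s
    induction r using MonoidAlgebra.induction_linear with
    | zero => simp
    | add r r' hr hr' =>
      rw [add_mul, map_add, hr, hr', map_add, map_add]
      ring
    | single R a =>
      induction s using MonoidAlgebra.induction_linear with
      | zero => simp
      | add s s' hs hs' =>
        rw [mul_add, map_add, hs, hs', map_add, map_add]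
        ring
      | single S b =>
        have hRS : d (MonoidAlgebra.single (R * S) 1) = _ := h R S
        rw [MonoidAlgebra.single_mul_single, characterHom_single, characterHom_single,
          linearMap_single d (R * S), linearMap_single d R, linearMap_single d S, hRS]
        ring

theorem eq_inner_iff {P Q : SetComposition A} {d d₀ : SolomonTits F A →ₗ[F] F} {a c : F} :
    (∀ r, d r = a * d₀ r + c * (P.characterHom F r - Q.characterHom F r)) ↔
      ∀ R : SetComposition A, d (MonoidAlgebra.single R 1) =
        a * d₀ (MonoidAlgebra.single R 1) + c * (P.character F R - Q.character F R) := by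
  constructor
  · intro h R
    rw [h, characterHom_single, characterHom_single, one_mul, one_mul]
  · intro h r
    induction r using MonoidAlgebra.induction_linear with
    | zero => simp
    | add r r' hr hr' =>
      rw [map_add, hr, hr', map_add, map_add, map_add]
      ring
    | single R b =>
      rw [linearMap_single d, linearMap_single d₀, h, characterHom_single, characterHom_single]
      ring

theorem rank_ext_eq_zero (F : Type u) [Field F] {P Q : SetComposition A}
    (h : ¬ Q.support ⋖ P.support) :
    Module.rank F (Abelian.Ext.{u} (Q.irreducibleModule F) (P.irreducibleModule F) 1) = 0 := by
  refine rank_ext_characterModule_eq_zero fun d hd => ?_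
  obtain ⟨c, hc⟩ := (isSkewDerivation_iff.1 hd).exists_eq_of_not_covBy h
  refine ⟨c, fun r => ?_⟩
  have := (eq_inner_iff (d := d) (d₀ := 0) (a := 0) (c := c)).2 (by simpa using hc) r
  simpa using this

theorem rank_ext_eq_one (F : Type u) [Field F] {P Q : SetComposition A}
    (h : Q.support ⋖ P.support) :
    Module.rank F (Abelian.Ext.{u} (Q.irreducibleModule F) (P.irreducibleModule F) 1) = 1 := by
  obtain ⟨δ₀, hδ₀, hδ₀', hall⟩ := exists_isSkew_of_covBy F h
  have hext : (fun R => linearExtension δ₀ (MonoidAlgebra.single R 1)) = δ₀ := by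
    funext R
    rw [linearExtension_single, one_mul]
  refine rank_ext_characterModule_eq_one (linearExtension δ₀)
    (isSkewDerivation_iff.2 (by rwa [hext])) ?_ fun d hd => ?_
  · rintro ⟨c, hc⟩
    refine hδ₀' ⟨c, fun R => ?_⟩
    have := hc (MonoidAlgebra.single R 1)
    rwa [linearExtension_single, characterHom_single, characterHom_single, one_mul, one_mul,
      one_mul] at this
  · obtain ⟨a, c, hac⟩ := hall _ (isSkewDerivation_iff.1 hd)
    refine ⟨a, c, eq_inner_iff.2 fun R => ?_⟩
    rw [linearExtension_single, one_mul]
    exact hac R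

end SetComposition

/-! ### Invariance of Ext under isomorphism -/

section ExtIso

open Abelian

theorem CategoryTheory.Abelian.Ext.rank_eq_of_iso {C : Type v} [Category.{w} C] [Abelian C]
    [HasExt.{u} C] (k : Type*) [Field k] [Linear k C] {X X' Y Y' : C} (e : X ≅ X') (e' : Y ≅ Y')
    (n : ℕ) : Module.rank k (Ext.{u} X Y n) = Module.rank k (Ext.{u} X' Y' n) :=
  LinearEquiv.rank_eq <| LinearEquiv.ofLinearMap
    ((Ext.precompOfLinear (Ext.mk₀ e.inv) k Y' (zero_add n)).comp
      (Ext.postcompOfLinear (Ext.mk₀ e'.hom) k X (add_zero n)))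
    ((Ext.precompOfLinear (Ext.mk₀ e.hom) k Y (zero_add n)).comp
      (Ext.postcompOfLinear (Ext.mk₀ e'.inv) k X' (add_zero n)))
    (by ext x; simp) (by ext x; simp)

end ExtIso

/-! ### Classification of the simple modules and the Ext-quiver -/

namespace SetComposition

variable {A : Finset ℕ} {F : Type u} [Field F]

/-- Every simple module is one on which all elements act through the character of some set
composition. -/
theorem exists_smul_eq_character_smul (V : Type v) [AddCommGroup V] [Module (SolomonTits F A) V]
    [IsSimpleModule (SolomonTits F A) V] :
    ∃ P : SetComposition A, ∀ (r : SolomonTits F A) (v : V),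
      r • v = algebraMap F (SolomonTits F A) (P.characterHom F r) • v := by
  have hV : Nontrivial V := IsSimpleModule.nontrivial (SolomonTits F A) V
  let T : Set (Finpartition A) := {π | ∃ P : SetComposition A, P.support = π ∧
    ∃ v : V, (MonoidAlgebra.single P 1 : SolomonTits F A) • v ≠ 0}
  have hT : T.Nonempty := by
    obtain ⟨v, hv⟩ := exists_ne (0 : V)
    refine ⟨_, 1, rfl, v, ?_⟩
    rwa [← MonoidAlgebra.one_def, one_smul]
  -- Choose P with minimal support among the compositions that act nontrivially. If P does not
  -- refine S, then PS has strictly smaller support and acts as zero, so pr acts as χ_P(r)p.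
  obtain ⟨_, ⟨P, rfl, v₀, hv₀⟩, hmin⟩ := wellFounded_lt.has_min T hT
  let p : SolomonTits F A := MonoidAlgebra.single P 1
  have key : ∀ (r : SolomonTits F A) (v : V),
      (p * r) • v = algebraMap F (SolomonTits F A) (P.characterHom F r) • p • v := by
    intro r v
    induction r using MonoidAlgebra.induction_linear with
    | zero => simp
    | add r s hr hs => rw [mul_add, add_smul, hr, hs, map_add, map_add, add_smul]
    | single S c =>
      rw [characterHom_single, MonoidAlgebra.single_mul_single, one_mul]
      have hc : (MonoidAlgebra.single (P * S) c : SolomonTits F A) =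
          algebraMap F (SolomonTits F A) c * MonoidAlgebra.single (P * S) 1 := by
        rw [← Algebra.smul_def, MonoidAlgebra.smul_single, smul_eq_mul, mul_one]
      by_cases hS : P.Refines S
      · rw [character_apply_of_refines hS, mul_one, hc, mul_eq_left_iff.2 hS, mul_smul]
      · rw [character_apply_of_not_refines hS, mul_zero, map_zero, zero_smul, hc, mul_smul]
        by_contra hne
        refine hmin (P * S).support ⟨P * S, rfl, v, fun h0 => hne (by rw [h0, smul_zero])⟩
          (lt_of_le_of_ne (support_le_support_iff.2 (mul_refines_left P S)) fun heq => hS ?_)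
        exact (support_le_support_iff.1 heq.ge).trans (mul_refines_right P S)
  refine ⟨P, ?_⟩
  -- W measures the failure of the algebra to act through χ_P. It is annihilated by p, whereas V is
  -- not, so simplicity forces W = 0.
  let W : Submodule (SolomonTits F A) V := Submodule.span (SolomonTits F A)
    {w | ∃ (r : SolomonTits F A) (v : V),
      r • v - algebraMap F (SolomonTits F A) (P.characterHom F r) • v = w}
  -- The factor a makes the claim stable under scalar multiplication, as the induction over the span
  -- requires.
  have hW : ∀ w ∈ W, ∀ a : SolomonTits F A, (p * a) • w = 0 := by
    intro w hw
    induction hw using Submodule.span_induction with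
    | mem w hw =>
      obtain ⟨r, v, rfl⟩ := hw
      intro a
      rw [smul_sub, ← mul_smul, ← mul_smul, mul_assoc, mul_assoc, key, key,
        map_mul (P.characterHom F), map_mul (P.characterHom F), AlgHom.commutes,
        Algebra.algebraMap_self, RingHom.id_apply, sub_self]
    | zero => simp
    | add x y _ _ hx hy => intro a; rw [smul_add, hx, hy, add_zero]
    | smul b x _ hx => intro a; rw [← mul_smul, mul_assoc, hx]
  rcases eq_bot_or_eq_top W with hbot | htop
  · intro r v
    have : r • v - algebraMap F (SolomonTits F A) (P.characterHom F r) • v ∈ W :=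
      Submodule.subset_span ⟨r, v, rfl⟩
    rw [hbot, Submodule.mem_bot] at this
    exact sub_eq_zero.1 this
  · refine absurd ?_ hv₀
    have := hW v₀ (htop ▸ Submodule.mem_top) 1
    rwa [mul_one] at this

theorem vertex_surjective :
    Function.Surjective (fun P : SetComposition A => P.vertex F) := by
  intro x
  induction x using Quotient.inductionOn with
  | h M =>
    obtain ⟨V, hV⟩ := M
    obtain ⟨P, hP⟩ := exists_smul_eq_character_smul (F := F) (A := A) V
    refine ⟨P, Quotient.sound ?_⟩
    have hnt : Nontrivial V := IsSimpleModule.nontrivial (SolomonTits F A) V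
    obtain ⟨v, hv⟩ := exists_ne (0 : V)
    have := P.isSimpleModule_irreducibleModule F
    let f : P.irreducibleModule F →ₗ[SolomonTits F A] V :=
      { toFun := fun c => algebraMap F (SolomonTits F A) (show F from c) • v
        map_add' := fun c c' => by
          rw [← add_smul, ← map_add]
          rfl
        map_smul' := fun r c => by
          rw [RingHom.id_apply, hP r, ← mul_smul, ← map_mul]
          rfl }
    have hf : f ≠ 0 := fun h0 => hv (by
      have : algebraMap F (SolomonTits F A) 1 • v = 0 :=
        LinearMap.congr_fun h0 (show P.irreducibleModule F from (1 : F))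
      rwa [map_one, one_smul] at this)
    exact ⟨(LinearEquiv.ofBijective f (LinearMap.bijective_of_ne_zero hf)).toModuleIso⟩

/-- The element Q of the monoid acts as 1 on M_Q, but as 0 on M_P if P does not refine Q. -/
theorem refines_of_iso {P Q : SetComposition A}
    (e : P.irreducibleModule F ≅ Q.irreducibleModule F) : P.Refines Q := by
  by_contra h
  let f := e.toLinearEquiv
  let x : P.irreducibleModule F := show F from 1
  have hx : x ≠ 0 := one_ne_zero (α := F)
  have h1 : (MonoidAlgebra.single Q 1 : SolomonTits F A) • x = 0 := by
    change P.characterHom F (MonoidAlgebra.single Q 1) * (1 : F) = 0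
    rw [characterHom_single, character_apply_of_not_refines h, mul_zero, zero_mul]
  have h2 : (MonoidAlgebra.single Q 1 : SolomonTits F A) • f x = f x := by
    change Q.characterHom F (MonoidAlgebra.single Q 1) * (show F from f x) = _
    rw [characterHom_single, character_apply_of_refines (Refines.refl Q), mul_one]
    exact one_mul _
  rw [← map_smul, h1, map_zero] at h2
  exact hx (f.map_eq_zero_iff.1 h2.symm)

theorem character_eq_of_support_eq {P Q : SetComposition A} (h : P.support = Q.support) :
    P.character F = Q.character F := by
  ext R
  have hR : P.Refines R ↔ Q.Refines R := by
    rw [← support_le_support_iff, ← support_le_support_iff, h]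
  by_cases hP : P.Refines R
  · rw [character_apply_of_refines hP, character_apply_of_refines (hR.1 hP)]
  · rw [character_apply_of_not_refines hP, character_apply_of_not_refines (mt hR.2 hP)]

theorem vertex_eq_vertex_iff {P Q : SetComposition A} :
    P.vertex F = Q.vertex F ↔ P.support = Q.support := by
  constructor
  · intro h
    obtain ⟨e⟩ : Nonempty (P.irreducibleModule F ≅ Q.irreducibleModule F) := Quotient.exact h
    exact le_antisymm (support_le_support_iff.2 (refines_of_iso e))
      (support_le_support_iff.2 (refines_of_iso e.symm))
  · intro h
    refine Quotient.sound ⟨eqToIso ?_⟩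
    change P.irreducibleModule F = Q.irreducibleModule F
    rw [irreducibleModule, irreducibleModule, characterHom, characterHom,
      character_eq_of_support_eq h]

/-- Arrows are defined through chosen representatives of the classes; the rank of Ext does not
depend on that choice. -/
theorem mk_hom_vertex (P Q : SetComposition A) :
    Cardinal.mk (P.vertex F ⟶ Q.vertex F) = Module.rank F
      (Abelian.Ext.{u} (Q.irreducibleModule F) (P.irreducibleModule F) 1) := by
  obtain ⟨e⟩ : Nonempty ((Quotient.out (s := SimpleMod.setoid (SolomonTits F A)) (Q.vertex F)).1 ≅
    Q.irreducibleModule F) := Quotient.exact (Quotient.out_eq (Q.vertex F))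
  obtain ⟨e'⟩ : Nonempty ((Quotient.out (s := SimpleMod.setoid (SolomonTits F A)) (P.vertex F)).1 ≅
    P.irreducibleModule F) := Quotient.exact (Quotient.out_eq (P.vertex F))
  rw [← Abelian.Ext.rank_eq_of_iso F e e' 1]
  exact (Module.Basis.ofVectorSpace F _).mk_eq_rank''

theorem nonempty_unique_hom_vertex {P Q : SetComposition A} (h : Q.support ⋖ P.support) :
    Nonempty (Unique (P.vertex F ⟶ Q.vertex F)) := by
  have h1 := mk_hom_vertex (F := F) P Q
  rw [rank_ext_eq_one F h] at h1
  exact (unique_iff_subsingleton_and_nonempty _).2 (Cardinal.eq_one_iff_unique.1 h1)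

theorem isEmpty_hom_vertex {P Q : SetComposition A} (h : ¬ Q.support ⋖ P.support) :
    IsEmpty (P.vertex F ⟶ Q.vertex F) := by
  have h1 := mk_hom_vertex (F := F) P Q
  rw [rank_ext_eq_zero F h] at h1
  exact Cardinal.mk_eq_zero_iff.1 h1

/-- Common form of both quiver isomorphisms. Both quivers have at most one arrow between two
vertices, so bijectivity on arrows only asks when an arrow exists. -/
theorem exists_prefunctor_of_bijective_support {V : Type v} [Quiver.{0} V]
    (s : V → SetComposition A)
    (hs : Function.Bijective fun x => (s x).support) (hsub : ∀ x y : V, Subsingleton (x ⟶ y))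
    (hcov : ∀ x y : V, Nonempty (x ⟶ y) ↔ (s y).support ⋖ (s x).support) :
    ∃ φ : Prefunctor V (ExtQuiver F (SolomonTits F A)),
      φ.IsIsomorphism ∧ ∀ x, φ.obj x = (s x).vertex F := by
  have hobj : Function.Bijective fun x => (s x).vertex F := by
    constructor
    · exact fun x y hxy => hs.1 (vertex_eq_vertex_iff.1 hxy)
    · intro a
      obtain ⟨P, rfl⟩ := vertex_surjective a
      obtain ⟨x, hx⟩ := hs.2 P.support
      exact ⟨x, vertex_eq_vertex_iff.2 hx⟩
  have huniq : ∀ x y : V, (x ⟶ y) → Nonempty (Unique ((s x).vertex F ⟶ (s y).vertex F)) :=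
    fun x y a => nonempty_unique_hom_vertex ((hcov x y).1 ⟨a⟩)
  refine ⟨⟨fun x => (s x).vertex F, fun {x y} a => (huniq x y a).some.default⟩, ⟨hobj, ?_⟩,
    fun _ => rfl⟩
  intro x y
  refine ⟨fun a b _ => (hsub x y).elim a b, fun b => ?_⟩
  by_cases h : (s y).support ⋖ (s x).support
  · obtain ⟨a⟩ := (hcov x y).2 h
    obtain ⟨hu⟩ := huniq x y a
    exact ⟨a, Subsingleton.elim _ _⟩
  · exact ((isEmpty_hom_vertex h).false b).elim

end SetComposition

/-! ### Ordering the components by their minima -/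

namespace OrderedComposition

variable {A : Finset ℕ}

theorem support_injective :
    Function.Injective fun P : OrderedComposition A => P.1.support := by
  intro P Q h
  refine Subtype.ext (SetComposition.ext ?_)
  have hperm : P.1.parts.Perm Q.1.parts :=
    (List.perm_ext_iff_of_nodup P.1.nodup_parts Q.1.nodup_parts).2 fun p => by
      rw [← SetComposition.mem_support_parts, ← SetComposition.mem_support_parts]
      exact iff_of_eq (congrArg (p ∈ ·.parts) h)
  exact hperm.eq_of_pairwise (fun _ _ _ _ h1 h2 => (lt_asymm h1 h2).elim) P.2 Q.2

theorem support_surjective :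
    Function.Surjective fun P : OrderedComposition A => P.1.support := by
  intro π
  obtain ⟨S, rfl⟩ := SetComposition.support_surjective π
  let L := S.parts.insertionSort fun p q => p.min ≤ q.min
  have hperm : L.Perm S.parts := List.perm_insertionSort _ _
  have hsort : L.Pairwise fun p q => p.min ≤ q.min := by
    have : Std.Total (fun p q : Finset ℕ => p.min ≤ q.min) := ⟨fun p q => le_total _ _⟩
    have : IsTrans (Finset ℕ) (fun p q : Finset ℕ => p.min ≤ q.min) := ⟨fun _ _ _ => le_trans⟩
    exact List.pairwise_insertionSort _ _
  have hdisj : L.Pairwise Disjoint := (hperm.pairwise_iff fun h => h.symm).2 S.disjoint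
  refine ⟨⟨⟨L, fun p hp => S.nonempty p (hperm.mem_iff.1 hp), hdisj, fun a => ?_⟩, ?_⟩, ?_⟩
  · simp only [S.union a, hperm.mem_iff]
  -- Disjoint non-empty components cannot share a minimum, so the sorted list is strictly
  -- increasing.
  · refine (hsort.and hdisj).imp_of_mem fun {p q} hp _ h => lt_of_le_of_ne h.1 fun heq => ?_
    obtain ⟨a, ha⟩ := Finset.min_of_nonempty (S.nonempty p (hperm.mem_iff.1 hp))
    exact Finset.disjoint_left.1 h.2 (Finset.mem_of_min ha) (Finset.mem_of_min (heq ▸ ha))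
  · ext p
    rw [SetComposition.mem_support_parts, SetComposition.mem_support_parts]
    exact hperm.mem_iff

end OrderedComposition

/-! ### The main theorem -/

theorem theorem8p1 (F : Type u) [Field F] (A : Finset ℕ) :
    IsSupportLattice (SetComposition.support : SetComposition A → Finpartition A) ∧
    (∃ θ : Prefunctor (HasseQuiver (Finpartition A)) (ExtQuiver F (SolomonTits F A)),
      θ.IsIsomorphism ∧ ∀ P : SetComposition A, θ.obj P.support = P.vertex F) ∧
    (∃ ψ : Prefunctor (OrderedComposition A) (ExtQuiver F (SolomonTits F A)),
      ψ.IsIsomorphism ∧ ∀ P : OrderedComposition A, ψ.obj P = P.1.vertex F) ∧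
    (∀ P Q : OrderedComposition A,
      (P.Arrow Q → Module.rank F
        (Abelian.Ext.{u} (Q.1.irreducibleModule F) (P.1.irreducibleModule F) 1) = 1) ∧
      (¬ P.Arrow Q → Module.rank F
        (Abelian.Ext.{u} (Q.1.irreducibleModule F) (P.1.irreducibleModule F) 1) = 0)) := by
  refine ⟨SetComposition.isSupportLattice_support, ?_, ?_, fun P Q => ⟨fun h => ?_, fun h => ?_⟩⟩
  -- A section of the support map suffices, because M_P depends up to isomorphism only on the
  -- support of P.
  · choose s hs using SetComposition.support_surjective (A := A)
    have hbij : Function.Bijective fun π : HasseQuiver (Finpartition A) => (s π).support :=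
      ⟨fun x y h => (hs x).symm.trans (h.trans (hs y)), fun π => ⟨π, hs π⟩⟩
    have hcov : ∀ x y : Finpartition A, (s y).support ⋖ (s x).support ↔ y ⋖ x := fun x y => by
      rw [hs, hs]
    have hsub : ∀ x y : HasseQuiver (Finpartition A), Subsingleton (x ⟶ y) :=
      fun x y => inferInstanceAs (Subsingleton (PLift (@CovBy (Finpartition A) _ y x)))
    have hhom : ∀ x y : HasseQuiver (Finpartition A),
        Nonempty (x ⟶ y) ↔ (s y).support ⋖ (s x).support := fun x y =>
      ⟨fun ⟨h⟩ => (hcov x y).2 h.down, fun h => ⟨⟨(hcov x y).1 h⟩⟩⟩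
    obtain ⟨θ, hθ, hobj⟩ :=
      SetComposition.exists_prefunctor_of_bijective_support (F := F) _ hbij hsub hhom
    exact ⟨θ, hθ, fun P => (hobj P.support).trans (SetComposition.vertex_eq_vertex_iff.2 (hs _))⟩
  · have hsub : ∀ x y : OrderedComposition A, Subsingleton (x ⟶ y) :=
      fun x y => inferInstanceAs (Subsingleton (PLift (x.Arrow y)))
    have hhom : ∀ x y : OrderedComposition A,
        Nonempty (x ⟶ y) ↔ y.1.support ⋖ x.1.support := fun x y =>
      ⟨fun ⟨h⟩ => SetComposition.support_covBy_support_iff.2 h.down,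
        fun h => ⟨⟨SetComposition.support_covBy_support_iff.1 h⟩⟩⟩
    have hbij : Function.Bijective fun P : OrderedComposition A => P.1.support :=
      ⟨OrderedComposition.support_injective, OrderedComposition.support_surjective⟩
    obtain ⟨ψ, hψ, hobj⟩ :=
      SetComposition.exists_prefunctor_of_bijective_support (F := F) _ hbij hsub hhom
    exact ⟨ψ, hψ, hobj⟩
  · exact SetComposition.rank_ext_eq_one F (SetComposition.support_covBy_support_iff.2 h)
  · exact SetComposition.rank_ext_eq_zero F (mt SetComposition.support_covBy_support_iff.1 h)
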